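/- Let $\ell, L>0$ and put $\mathbf Q_1=[0,\ell]\times[0,1]$, $\mathbf Q_2=[0,L]\times[0,1]$, regarded as subsets of $\mathbb C$ with $z=x+iy$. Let $\mathcal F$ be the family of all homeomorphisms $f$ of $\mathbf Q_1$ onto $\mathbf Q_2$ such that * (boundary conditions) $\operatorname{Re} f(0,y)=0$ and $\operatorname{Re} f(\ell,y)=L$ for $0\le y\le 1$, and $\operatorname{Im} f(x,0)=0$ and $\operatorname{Im} f(x,1)=1$ for $0\le x\le \ell$; * (finite distortion) $f$ belongs to $W^{1,1}_{loc}$ of the interior of $\mathbf Q_1$, and with its weak derivatives $f_x,f_y$, $|Df|^2=|f_x|^2+|f_y|^2$ and $J(z,f)=\operatorname{Im}(f_y\overline{f_x})$, one has $J(z,f)\ge 0$ and $|Df(z)|^2\le K(z)\,J(z,f)$ for almost every $z$, for some finite function $K$. For $f\in\mathcal F$ let $\mathbb K(z,f)=|Df(z)|^2/J(z,f)$ where $J(z,f)>0$ and $\mathbb K(z,f)=2$ (the least value of this quotient) elsewhere. Let $\lambda:[0,\ell]\to(0,\infty)$ be continuous except at finitely many points, bounded, and bounded away from $0$. Let $\varphi:[1,\infty)\to[0,\infty)$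 be $C^\infty$-smooth, convex and strictly increasing, with $\varphi'$ unbounded. Then the minimisation problem $$\min_{f\in\mathcal F}\int_{\mathbf Q_1}\varphi(\mathbb K(z,f))\,\lambda(x)\,|dz|^2$$ has a minimiser $f\in\mathcal F$, with a finite minimum. It is unique in $\mathcal F$, and it has the form $f(z)=u(x)+iy$ for a function $u:[0,\ell]\to[0,L]$. -/

import Mathlib

open Set MeasureTheory
open scoped ContDiff

namespace Grotzsch

/-- The closed rectangle `[0, a] × [0, 1]` in the complex plane. -/
def rect (a : ℝ) : Set ℂ := Icc 0 a ×ℂ Icc 0 1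

/-- The open rectangle `(0, a) × (0, 1)` in the complex plane. -/
def openRect (a : ℝ) : Set ℂ := Ioo 0 a ×ℂ Ioo 0 1

/-- `g` is locally integrable on `Ω` and is the weak (distributional) derivative of `f` on `Ω` in
the direction `v`: integration by parts against `C^∞` functions with compact support in `Ω`. -/
def IsWeakPartial (Ω : Set ℂ) (v : ℂ) (f g : ℂ → ℂ) : Prop :=
  LocallyIntegrableOn g Ω ∧
    ∀ η : ℂ → ℝ, ContDiff ℝ ∞ η → HasCompactSupport η → tsupport η ⊆ Ω →
      ∫ z, (fderiv ℝ η z v) • f z = - ∫ z, η z • g z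

/-- The local Sobolev space `W^{1,1}_loc(Ω, ℂ)`. -/
def MemW11loc (Ω : Set ℂ) (f : ℂ → ℂ) : Prop :=
  LocallyIntegrableOn f Ω ∧
    (∃ g, IsWeakPartial Ω 1 f g) ∧ (∃ g, IsWeakPartial Ω Complex.I f g)

open Classical in
/-- The weak derivative of `f` on `Ω` in the direction `v` (unique up to null sets of `Ω`); it is
only used for functions `f` that have one. -/
noncomputable def weakPartial (Ω : Set ℂ) (v : ℂ) (f : ℂ → ℂ) : ℂ → ℂ :=
  if h : ∃ g, IsWeakPartial Ω v f g then h.choose else 0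

/-- `|Df|² = |f_x|² + |f_y|²`, the squared Hilbert–Schmidt norm of the weak differential. -/
noncomputable def normDSq (Ω : Set ℂ) (f : ℂ → ℂ) (z : ℂ) : ℝ :=
  ‖weakPartial Ω 1 f z‖ ^ 2 + ‖weakPartial Ω Complex.I f z‖ ^ 2

/-- The Jacobian determinant `J(z, f) = Re f_x Im f_y - Im f_x Re f_y`. -/
noncomputable def jacobian (Ω : Set ℂ) (f : ℂ → ℂ) (z : ℂ) : ℝ :=
  (weakPartial Ω 1 f z).re * (weakPartial Ω Complex.I f z).im -
    (weakPartial Ω 1 f z).im * (weakPartial Ω Complex.I f z).re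

/-- The distortion `𝕂(z, f) = (|f_x|² + |f_y|²) / J(z, f)`. Where `J = 0` (for a map of finite
distortion, where `Df = 0`, up to null sets) it is given the value `2` that it has at points of
conformality, which is the least value of `|Df|² / J`. -/
noncomputable def distortion (Ω : Set ℂ) (f : ℂ → ℂ) (z : ℂ) : ℝ :=
  if 0 < jacobian Ω f z then normDSq Ω f z / jacobian Ω f z else 2

/-- `f` is of finite distortion on `Ω`: it is of class `W^{1,1}_loc`, its Jacobian is nonnegative
almost everywhere, and `|Df(z)|² ≤ K(z) J(z, f)` for almost every `z`, for some finite function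
`K`. -/
def FiniteDistortion (Ω : Set ℂ) (f : ℂ → ℂ) : Prop :=
  MemW11loc Ω f ∧
    (∀ᵐ z ∂volume.restrict Ω, 0 ≤ jacobian Ω f z) ∧
    ∃ K : ℂ → ℝ, ∀ᵐ z ∂volume.restrict Ω, normDSq Ω f z ≤ K z * jacobian Ω f z

/-- The competing maps: homeomorphisms of `[0, ℓ] × [0, 1]` onto `[0, L] × [0, 1]` (the inverse is
continuous by compactness) of finite distortion that satisfy the Grötzsch boundary conditions. Only
the values on `[0, ℓ] × [0, 1]` matter. -/
structure Admissible (ℓ L : ℝ) (f : ℂ → ℂ) : Prop where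
  continuousOn : ContinuousOn f (rect ℓ)
  bijOn : BijOn f (rect ℓ) (rect L)
  finiteDistortion : FiniteDistortion (openRect ℓ) f
  left : ∀ z ∈ rect ℓ, z.re = 0 → (f z).re = 0
  right : ∀ z ∈ rect ℓ, z.re = ℓ → (f z).re = L
  bottom : ∀ z ∈ rect ℓ, z.im = 0 → (f z).im = 0
  top : ∀ z ∈ rect ℓ, z.im = 1 → (f z).im = 1

/-- The weighted mean distortion `∫ φ(𝕂(z, f)) w(x) |dz|²` over `[0, ℓ] × [0, 1]`, a value in
`[0, ∞]`. -/
noncomputable def energy (ℓ : ℝ) (φ w : ℝ → ℝ) (f : ℂ → ℂ) : ENNReal :=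
  ∫⁻ z in rect ℓ, ENNReal.ofReal (φ (distortion (openRect ℓ) f z) * w z.re)

/-- `f` attains the minimum of the weighted mean distortion among the competing maps, and that
minimum is finite. -/
def IsMinimiser (ℓ L : ℝ) (φ w : ℝ → ℝ) (f : ℂ → ℂ) : Prop :=
  Admissible ℓ L f ∧ energy ℓ φ w f ≠ ⊤ ∧
    ∀ g, Admissible ℓ L g → energy ℓ φ w f ≤ energy ℓ φ w g

/-- `w` is continuous on `[0, ℓ]` except at finitely many points. -/
def PiecewiseContinuous (ℓ : ℝ) (w : ℝ → ℝ) : Prop :=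
  ∃ S : Set ℝ, S.Finite ∧ ∀ x ∈ Icc 0 ℓ \ S, ContinuousWithinAt w (Icc 0 ℓ) x

end Grotzsch

/-!
The competing maps are compared with a single stretching `f (x + i y) = u x + i y`, where `u' = p`
solves the one-dimensional Euler–Lagrange equation: with `Φ q = φ (q + 1 / q)`, the product
`w * Φ' (p)` is a constant `α`, and `∫ p = L`. Since `φ'` is unbounded, `Φ'` is an increasing
bijection of `(0, ∞)` onto `ℝ`, so `p` can be found by the intermediate value theorem in `α`
(`exists_profile`).

Minimality is a calibration argument. For a competitor `g` with derivatives `X = g_x`, `Y = g_y`,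
Jacobian `J` and distortion `𝕂`, convexity of `φ` gives `φ 𝕂 ≥ φ t₀ + φ' (t₀) (𝕂 - t₀)` with
`t₀ = p + 1 / p`. Where `p > 1` one has `𝕂 - t₀ ≥ (1 - 1 / p ^ 2) (2 Re X - J - p)`, and where
`p < 1` one has `𝕂 - t₀ ≥ (1 / p ^ 2 - 1) (2 p Im Y - J - p)`; the cases correspond to `α > 0` and
`α < 0`. Multiplied by `w * φ' (t₀)`, the coefficients become the constant `|α|` (`density_lower`).
The right-hand sides then have nonnegative integral, as `∫ Re X = L` and `∫ p Im Y = ∫ p = L` by the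
boundary conditions (`integral_re_eq`, `integral_mul_im_eq`), while `∫ J ≤ L`. Equality forces
`X = p` and `Y = i` almost everywhere, and hence `g = f`. If `α = 0`, then `p = 1`, equality means
`|X| ^ 2 + |Y| ^ 2 = 2 J`, and the same three integrals give `∫ |X - 1| ^ 2 + |Y - i| ^ 2 ≤ 0`.

The analytic input is about continuous maps in `W^{1,1}_loc`. Testing against products shows that
such a map is absolutely continuous on almost every line (`IsWeakPartialSnd.ae_forall_sub_eq`), so
its weak partial derivatives are classical ones almost everywhere. By Egorov's theorem the vertical
difference quotients converge uniformly off a set of small measure, and within the remaining set the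
map is differentiable (`UniformLineDeriv.hasFDerivWithinAt`). The change of variables formula for
injective maps that are differentiable within a set then bounds the integral of the Jacobian by the
area of the image (`lintegral_jacobian_le`).
-/

namespace Grotzsch

open Filter Topology

/-! ### The one-dimensional Euler–Lagrange equation -/

section Integrand

variable {φ : ℝ → ℝ}

lemma hasDerivAt_of_contDiffOn_Ici (hs : ContDiffOn ℝ ∞ φ (Ici 1)) {t : ℝ} (ht : 1 < t) :
    HasDerivAt φ (deriv φ t) t :=
  ((hs.contDiffAt (Ici_mem_nhds ht)).differentiableAt (by simp)).hasDerivAt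

lemma continuousOn_deriv_Ioi (hs : ContDiffOn ℝ ∞ φ (Ici 1)) :
    ContinuousOn (deriv φ) (Ioi 1) :=
  (hs.mono Ioi_subset_Ici_self).continuousOn_deriv_of_isOpen isOpen_Ioi (by simp)

lemma monotoneOn_deriv_Ioi (hs : ContDiffOn ℝ ∞ φ (Ici 1)) (hc : ConvexOn ℝ (Ici 1) φ) :
    MonotoneOn (deriv φ) (Ioi 1) :=
  (hc.subset Ioi_subset_Ici_self (convex_Ioi 1)).monotoneOn_deriv
    fun _ hx => (hasDerivAt_of_contDiffOn_Ici hs hx).differentiableAt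

lemma deriv_pos_of_strictMonoOn (hs : ContDiffOn ℝ ∞ φ (Ici 1)) (hc : ConvexOn ℝ (Ici 1) φ)
    (hi : StrictMonoOn φ (Ici 1)) {t : ℝ} (ht : 1 < t) : 0 < deriv φ t := by
  have h := hc.slope_le_deriv (mem_Ici.2 le_rfl) (mem_Ici.2 ht.le) ht
    (hasDerivAt_of_contDiffOn_Ici hs ht).differentiableAt
  refine lt_of_lt_of_le ?_ h
  rw [slope_def_field]
  exact div_pos (sub_pos.2 (hi (mem_Ici.2 le_rfl) (mem_Ici.2 ht.le) ht)) (sub_pos.2 ht)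

lemma tangent_le (hs : ContDiffOn ℝ ∞ φ (Ici 1)) (hc : ConvexOn ℝ (Ici 1) φ) {t s : ℝ}
    (ht : 1 < t) (h1s : 1 ≤ s) : φ t + deriv φ t * (s - t) ≤ φ s := by
  have hd := (hasDerivAt_of_contDiffOn_Ici hs ht).differentiableAt
  rcases lt_trichotomy s t with h | rfl | h
  · have := hc.slope_le_deriv (mem_Ici.2 h1s) (mem_Ici.2 ht.le) h hd
    rw [slope_def_field, div_le_iff₀ (sub_pos.2 h)] at this
    linarith
  · simp
  · have := hc.deriv_le_slope (mem_Ici.2 ht.le) (mem_Ici.2 h1s) h hd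
    rw [slope_def_field, le_div_iff₀ (sub_pos.2 h)] at this
    linarith

lemma tendsto_deriv_atTop (hs : ContDiffOn ℝ ∞ φ (Ici 1)) (hc : ConvexOn ℝ (Ici 1) φ)
    (hu : ¬ BddAbove (deriv φ '' Ioi 1)) : Tendsto (deriv φ) atTop atTop := by
  rw [tendsto_atTop]
  intro b
  rw [not_bddAbove_iff] at hu
  obtain ⟨_, ⟨t, ht, rfl⟩, hbt⟩ := hu b
  filter_upwards [eventually_ge_atTop t] with s hts
  exact hbt.le.trans (monotoneOn_deriv_Ioi hs hc ht (lt_of_lt_of_le ht hts) hts)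

/-- The derivative of `q ↦ φ (q + 1 / q)`. For the map `(x, y) ↦ (u x, y)`, whose distortion is
`u' + 1 / u'`, the Euler–Lagrange equation says that `w * profileDeriv φ u'` is constant. -/
noncomputable def profileDeriv (φ : ℝ → ℝ) (q : ℝ) : ℝ :=
  deriv φ (q + q⁻¹) * (1 - (q ^ 2)⁻¹)

lemma two_le_add_inv {q : ℝ} (hq : 0 < q) : 2 ≤ q + q⁻¹ := by
  have : q + q⁻¹ - 2 = (q - 1) ^ 2 / q := by field_simp; ring
  have h2 : 0 ≤ (q - 1) ^ 2 / q := by positivity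
  linarith

lemma continuous_profileDeriv_exp (hs : ContDiffOn ℝ ∞ φ (Ici 1)) :
    Continuous fun t => profileDeriv φ (Real.exp t) := by
  unfold profileDeriv
  refine Continuous.mul ?_ ?_
  · refine (continuousOn_deriv_Ioi hs).comp_continuous ?_ ?_
    · exact Real.continuous_exp.add (Real.continuous_exp.inv₀ fun t => (Real.exp_pos t).ne')
    · intro t
      have := two_le_add_inv (Real.exp_pos t)
      exact mem_Ioi.2 (by linarith)
  · exact continuous_const.sub ((Real.continuous_exp.pow 2).inv₀
      fun t => (pow_pos (Real.exp_pos t) 2).ne')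

lemma strictMonoOn_profileDeriv (hs : ContDiffOn ℝ ∞ φ (Ici 1)) (hc : ConvexOn ℝ (Ici 1) φ)
    (hi : StrictMonoOn φ (Ici 1)) : StrictMonoOn (profileDeriv φ) (Ioi 0) := by
  intro a ha b hb hab
  rw [mem_Ioi] at ha hb
  have ha2 := two_le_add_inv ha
  have hb2 := two_le_add_inv hb
  have pa := deriv_pos_of_strictMonoOn hs hc hi (t := a + a⁻¹) (by linarith)
  have pb := deriv_pos_of_strictMonoOn hs hc hi (t := b + b⁻¹) (by linarith)
  have hinv : (b ^ 2)⁻¹ < (a ^ 2)⁻¹ := by gcongr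
  have key : (b + b⁻¹) - (a + a⁻¹) = (b - a) * (a * b - 1) / (a * b) := by field_simp; ring
  have hab0 : 0 < a * b := mul_pos ha hb
  unfold profileDeriv
  -- Both factors increase if `1 ≤ a * b`; otherwise `q + 1 / q` decreases from `a` to `b`, and the
  -- second factor is negative at `a`.
  rcases le_total 1 (a * b) with h | h
  · have hle : a + a⁻¹ ≤ b + b⁻¹ := by
      have : 0 ≤ (b - a) * (a * b - 1) / (a * b) :=
        div_nonneg (mul_nonneg (by linarith) (by linarith)) hab0.le
      linarith
    have hm := monotoneOn_deriv_Ioi hs hc (mem_Ioi.2 (by linarith)) (mem_Ioi.2 (by linarith)) hle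
    have hb1 : 0 ≤ 1 - (b ^ 2)⁻¹ := by
      have : 1 ≤ b ^ 2 := by nlinarith
      have := inv_le_one_of_one_le₀ this
      linarith
    calc _ < deriv φ (a + a⁻¹) * (1 - (b ^ 2)⁻¹) := by gcongr
      _ ≤ _ := by gcongr
  · have hle : b + b⁻¹ ≤ a + a⁻¹ := by
      have : (b - a) * (a * b - 1) / (a * b) ≤ 0 :=
        div_nonpos_of_nonpos_of_nonneg
          (mul_nonpos_of_nonneg_of_nonpos (by linarith) (by linarith)) hab0.le
      linarith
    have hm := monotoneOn_deriv_Ioi hs hc (mem_Ioi.2 (by linarith)) (mem_Ioi.2 (by linarith)) hle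
    have ha1 : 1 - (a ^ 2)⁻¹ ≤ 0 := by
      have : a ^ 2 ≤ 1 := by nlinarith
      have := one_le_inv_iff₀.2 ⟨by positivity, this⟩
      linarith
    calc _ ≤ deriv φ (b + b⁻¹) * (1 - (a ^ 2)⁻¹) := mul_le_mul_of_nonpos_right hm ha1
      _ < _ := by gcongr

lemma tendsto_profileDeriv_atTop (hs : ContDiffOn ℝ ∞ φ (Ici 1)) (hc : ConvexOn ℝ (Ici 1) φ)
    (hu : ¬ BddAbove (deriv φ '' Ioi 1)) : Tendsto (profileDeriv φ) atTop atTop := by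
  unfold profileDeriv
  have h1 : Tendsto (fun q : ℝ => q + q⁻¹) atTop atTop :=
    tendsto_id.atTop_add tendsto_inv_atTop_zero
  have h2 : Tendsto (fun q : ℝ => 1 - (q ^ 2)⁻¹) atTop (𝓝 (1 - 0)) :=
    tendsto_const_nhds.sub ((tendsto_pow_atTop two_ne_zero).inv_tendsto_atTop)
  exact ((tendsto_deriv_atTop hs hc hu).comp h1).atTop_mul_pos (by norm_num) h2

lemma tendsto_profileDeriv_inv_atTop (hs : ContDiffOn ℝ ∞ φ (Ici 1))
    (hc : ConvexOn ℝ (Ici 1) φ) (hu : ¬ BddAbove (deriv φ '' Ioi 1)) :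
    Tendsto (fun q => profileDeriv φ q⁻¹) atTop atBot := by
  unfold profileDeriv
  have h1 : Tendsto (fun q : ℝ => q⁻¹ + q⁻¹⁻¹) atTop atTop := by
    simp only [inv_inv]
    exact tendsto_inv_atTop_zero.add_atTop tendsto_id
  have h2 : Tendsto (fun q : ℝ => 1 - (q⁻¹ ^ 2)⁻¹) atTop atBot := by
    simp only [inv_pow, inv_inv]
    exact tendsto_const_nhds.add_atBot (tendsto_neg_atTop_atBot.comp (tendsto_pow_atTop two_ne_zero))
  exact ((tendsto_deriv_atTop hs hc hu).comp h1).atTop_mul_atBot₀ h2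

/-- `profileDeriv φ` is an increasing bijection of `(0, ∞)` onto `ℝ`; this is its inverse. -/
lemma exists_profileDeriv_inverse (hs : ContDiffOn ℝ ∞ φ (Ici 1)) (hc : ConvexOn ℝ (Ici 1) φ)
    (hi : StrictMonoOn φ (Ici 1)) (hu : ¬ BddAbove (deriv φ '' Ioi 1)) :
    ∃ Q : ℝ → ℝ, Continuous Q ∧ Monotone Q ∧ (∀ s, 0 < Q s) ∧
      (∀ s, profileDeriv φ (Q s) = s) ∧ ∀ q, 0 < q → Q (profileDeriv φ q) = q := by
  set H : ℝ → ℝ := fun t => profileDeriv φ (Real.exp t) with hH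
  have hmono : StrictMono H := fun a b hab =>
    strictMonoOn_profileDeriv hs hc hi (mem_Ioi.2 (Real.exp_pos a)) (mem_Ioi.2 (Real.exp_pos b))
      (Real.exp_lt_exp.2 hab)
  have hbot : Tendsto H atBot atBot := by
    have : H = (fun q => profileDeriv φ q⁻¹) ∘ (fun t => Real.exp (-t)) := by
      funext t; simp [hH, Real.exp_neg]
    rw [this]
    exact (tendsto_profileDeriv_inv_atTop hs hc hu).comp
      (Real.tendsto_exp_atTop.comp tendsto_neg_atBot_atTop)
  have hsurj : Function.Surjective H :=
    (continuous_profileDeriv_exp hs).surjective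
      ((tendsto_profileDeriv_atTop hs hc hu).comp Real.tendsto_exp_atTop) hbot
  set e := hmono.orderIsoOfSurjective H hsurj with he
  have heH : ∀ t, e t = H t := fun t => rfl
  refine ⟨fun s => Real.exp (e.symm s), Real.continuous_exp.comp e.symm.continuous,
    Real.exp_monotone.comp e.symm.monotone, fun s => Real.exp_pos _, fun s => ?_, fun q hq => ?_⟩
  · change H (e.symm s) = s
    rw [← heH, e.apply_symm_apply]
  · have : profileDeriv φ q = e (Real.log q) := by
      rw [heH]; simp only [hH, Real.exp_log hq]
    simp only [this, e.symm_apply_apply, Real.exp_log hq]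

/-- The one-dimensional Euler–Lagrange equation with prescribed mean: a profile `p` with
`W * profileDeriv φ p` constant and `∫ p = L`. -/
lemma exists_profile (hs : ContDiffOn ℝ ∞ φ (Ici 1)) (hc : ConvexOn ℝ (Ici 1) φ)
    (hi : StrictMonoOn φ (Ici 1)) (hu : ¬ BddAbove (deriv φ '' Ioi 1))
    {ℓ L : ℝ} (hℓ : 0 < ℓ) (hL : 0 < L) {W : ℝ → ℝ} (hW : Measurable W) {m M : ℝ} (hm : 0 < m)
    (hmW : ∀ x, m ≤ W x) (hWM : ∀ x, W x ≤ M) :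
    ∃ (α : ℝ) (p : ℝ → ℝ), Measurable p ∧ (∃ a, 0 < a ∧ ∀ x, a ≤ p x) ∧ (∃ b, ∀ x, p x ≤ b) ∧
      (∀ x, W x * profileDeriv φ (p x) = α) ∧ ∫ x in (0 : ℝ)..ℓ, p x = L := by
  obtain ⟨Q, hQc, hQm, hQpos, hQ1, hQ2⟩ := exists_profileDeriv_inverse hs hc hi hu
  have hWpos : ∀ x, 0 < W x := fun x => hm.trans_le (hmW x)
  have hMpos : 0 < M := (hWpos 0).trans_le (hWM 0)
  have hbound : ∀ α x, |α / W x| ≤ |α| / m := fun α x => by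
    rw [abs_div, abs_of_pos (hWpos x)]
    exact div_le_div_of_nonneg_left (abs_nonneg α) hm (hmW x)
  have hmeas : ∀ α, Measurable fun x => Q (α / W x) := fun α =>
    hQc.measurable.comp (measurable_const.div hW)
  have hlow : ∀ α x, Q (-(|α| / m)) ≤ Q (α / W x) := fun α x => hQm (abs_le.1 (hbound α x)).1
  have hup : ∀ α x, Q (α / W x) ≤ Q (|α| / m) := fun α x => hQm (abs_le.1 (hbound α x)).2
  set G : ℝ → ℝ := fun α => ∫ x in (0 : ℝ)..ℓ, Q (α / W x) with hG
  have hint : ∀ α, IntervalIntegrable (fun x => Q (α / W x)) volume 0 ℓ := fun α => by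
    refine (intervalIntegrable_const (c := Q (|α| / m))).mono_fun'
      (hmeas α).aestronglyMeasurable (ae_of_all _ fun x => ?_)
    change ‖Q (α / W x)‖ ≤ Q (|α| / m)
    rw [Real.norm_of_nonneg (hQpos _).le]
    exact hup α x
  have hGc : Continuous G := by
    rw [continuous_iff_continuousAt]
    intro α₀
    refine intervalIntegral.continuousAt_of_dominated_interval
      (bound := fun _ => Q ((|α₀| + 1) / m)) ?_ ?_ intervalIntegrable_const ?_
    · exact Eventually.of_forall fun α => (hmeas α).aestronglyMeasurable
    · filter_upwards [Metric.ball_mem_nhds α₀ one_pos] with α hα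
      refine ae_of_all _ fun x _ => ?_
      rw [Real.norm_of_nonneg (hQpos _).le]
      refine (hup α x).trans (hQm ?_)
      gcongr
      rw [Metric.mem_ball, Real.dist_eq] at hα
      have := abs_sub_abs_le_abs_sub α α₀
      linarith
    · exact ae_of_all _ fun x _ => (hQc.comp (continuous_id.div_const _)).continuousAt
  -- For a constant weight `M` the profile is the constant `L / ℓ`, with multiplier `M * k`. As
  -- `W ≤ M`, truncating this multiplier at `0` gives values on either side of `L`.
  set k := profileDeriv φ (L / ℓ) with hk
  have hLℓ : 0 < L / ℓ := div_pos hL hℓ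
  have hQk : Q k = L / ℓ := hQ2 _ hLℓ
  have hGconst : ∫ _x in (0 : ℝ)..ℓ, L / ℓ = L := by
    simp; field_simp
  have hhi : L ≤ G (max 0 (M * k)) := by
    rw [← hGconst]
    refine intervalIntegral.integral_mono_on hℓ.le intervalIntegrable_const (hint _) fun x _ => ?_
    rw [← hQk]
    refine hQm ?_
    rw [le_div_iff₀ (hWpos x)]
    rcases le_total 0 k with h | h
    · exact le_max_of_le_right (by nlinarith [hWM x])
    · exact le_max_of_le_left (mul_nonpos_of_nonpos_of_nonneg h (hWpos x).le)
  have hlo : G (min 0 (M * k)) ≤ L := by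
    rw [← hGconst]
    refine intervalIntegral.integral_mono_on hℓ.le (hint _) intervalIntegrable_const fun x _ => ?_
    rw [← hQk]
    refine hQm ?_
    rw [div_le_iff₀ (hWpos x)]
    rcases le_total 0 k with h | h
    · exact min_le_of_left_le (mul_nonneg h (hWpos x).le)
    · exact min_le_of_right_le (by nlinarith [hWM x])
  obtain ⟨α, hα⟩ : ∃ α, G α = L := mem_range_of_exists_le_of_exists_ge hGc ⟨_, hlo⟩ ⟨_, hhi⟩
  refine ⟨α, fun x => Q (α / W x), hmeas α, ⟨_, hQpos _, hlow α⟩, ⟨_, hup α⟩, fun x => ?_, hα⟩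
  simp only [hQ1]
  exact mul_div_cancel₀ _ (hWpos x).ne'

end Integrand

/-! ### Pointwise inequalities for the distortion of a matrix -/

section Pointwise

/-- The distortion of a planar linear map with columns `(a, b)` and `(c, d)`, with the value `2` if
the determinant is not positive. -/
noncomputable def matDistortion (a b c d : ℝ) : ℝ :=
  if 0 < a * d - b * c then (a ^ 2 + b ^ 2 + (c ^ 2 + d ^ 2)) / (a * d - b * c) else 2

lemma sum_sq_le_matDistortion_mul {a b c d k : ℝ}
    (h0 : 0 ≤ a * d - b * c)
    (hk : a ^ 2 + b ^ 2 + (c ^ 2 + d ^ 2) ≤ k * (a * d - b * c)) :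
    a ^ 2 + b ^ 2 + (c ^ 2 + d ^ 2) = matDistortion a b c d * (a * d - b * c) := by
  unfold matDistortion
  split_ifs with h
  · rw [div_mul_cancel₀ _ h.ne']
  · have h1 : a * d - b * c = 0 := le_antisymm (not_lt.1 h) h0
    rw [h1, mul_zero] at hk ⊢
    exact le_antisymm hk (by positivity)

lemma two_le_matDistortion (a b c d : ℝ) : 2 ≤ matDistortion a b c d := by
  unfold matDistortion
  split_ifs with h
  · rw [le_div_iff₀ h]
    nlinarith [sq_nonneg (a - d), sq_nonneg (b + c)]
  · exact le_rfl

lemma eq_zero_of_finite_distortion {a b c d k : ℝ}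
    (h0 : 0 ≤ a * d - b * c) (h : ¬ 0 < a * d - b * c)
    (hk : a ^ 2 + b ^ 2 + (c ^ 2 + d ^ 2) ≤ k * (a * d - b * c)) :
    a = 0 ∧ b = 0 ∧ c = 0 ∧ d = 0 := by
  have h1 : a * d - b * c = 0 := le_antisymm (not_lt.1 h) h0
  rw [h1, mul_zero] at hk
  refine ⟨?_, ?_, ?_, ?_⟩ <;> refine (pow_eq_zero_iff two_ne_zero).1 ?_ <;>
    linarith [sq_nonneg a, sq_nonneg b, sq_nonneg c, sq_nonneg d]

/-- Stretching in the `x`-direction: for `q > 1` the distortion dominates its value at the diagonal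
matrix `diag (q, 1)` plus a multiple of an affine function of the null Lagrangians `a` and
`a * d - b * c`, with equality only at `diag (q, 1)`. -/
lemma matDistortion_lower_of_one_lt {a b c d k q : ℝ} (hq : 1 < q)
    (h0 : 0 ≤ a * d - b * c)
    (hk : a ^ 2 + b ^ 2 + (c ^ 2 + d ^ 2) ≤ k * (a * d - b * c)) :
    (1 - (q ^ 2)⁻¹) * (2 * a - (a * d - b * c) - q) ≤ matDistortion a b c d - (q + q⁻¹) ∧
    ((1 - (q ^ 2)⁻¹) * (2 * a - (a * d - b * c) - q) = matDistortion a b c d - (q + q⁻¹) →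
      a = q ∧ b = 0 ∧ c = 0 ∧ d = 1) := by
  have hq0 : 0 < q := by linarith
  have hβ : 0 < 1 - (q ^ 2)⁻¹ := by
    have : (q ^ 2)⁻¹ < 1 := inv_lt_one_of_one_lt₀ (by nlinarith)
    linarith
  by_cases h : 0 < a * d - b * c
  · have hdist : matDistortion a b c d = (a ^ 2 + b ^ 2 + (c ^ 2 + d ^ 2)) / (a * d - b * c) := by
      simp [matDistortion, h]
    obtain ⟨J, hJ⟩ : ∃ J, J = a * d - b * c := ⟨_, rfl⟩
    rw [← hJ] at h hdist ⊢
    have hA : 0 < a ^ 2 + b ^ 2 := by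
      by_contra hcon
      have ha : a = 0 := (pow_eq_zero_iff two_ne_zero).1
        (by linarith [sq_nonneg a, sq_nonneg b])
      have hb : b = 0 := (pow_eq_zero_iff two_ne_zero).1
        (by linarith [sq_nonneg a, sq_nonneg b])
      simp [ha, hb] at hJ
      linarith
    -- Lagrange's identity turns the distortion into `r + 1 / r` plus a square, for the ratio
    -- `r = (a ^ 2 + b ^ 2) / J`; the three squares below vanish together only at `diag (q, 1)`.
    have hB : c ^ 2 + d ^ 2 = (J ^ 2 + (a * c + b * d) ^ 2) / (a ^ 2 + b ^ 2) := by
      rw [eq_div_iff hA.ne', hJ]; ring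
    have key : matDistortion a b c d - (q + q⁻¹) - (1 - (q ^ 2)⁻¹) * (2 * a - J - q) =
        (a * c + b * d) ^ 2 / ((a ^ 2 + b ^ 2) * J)
        + ((a ^ 2 + b ^ 2) - q * J) ^ 2 / ((a ^ 2 + b ^ 2) * J * q ^ 2)
        + (1 - (q ^ 2)⁻¹) * (((a - J) ^ 2 + b ^ 2) / J) := by
      rw [hdist, hB]
      field_simp
      ring
    have t1 : 0 ≤ (a * c + b * d) ^ 2 / ((a ^ 2 + b ^ 2) * J) := by positivity
    have t2 : 0 ≤ ((a ^ 2 + b ^ 2) - q * J) ^ 2 / ((a ^ 2 + b ^ 2) * J * q ^ 2) := by positivity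
    have t3 : 0 ≤ (1 - (q ^ 2)⁻¹) * (((a - J) ^ 2 + b ^ 2) / J) := by positivity
    refine ⟨by linarith, fun heq => ?_⟩
    have e1 : (a * c + b * d) ^ 2 / ((a ^ 2 + b ^ 2) * J) = 0 := by linarith
    have e2 : ((a ^ 2 + b ^ 2) - q * J) ^ 2 / ((a ^ 2 + b ^ 2) * J * q ^ 2) = 0 := by linarith
    have e3 : (1 - (q ^ 2)⁻¹) * (((a - J) ^ 2 + b ^ 2) / J) = 0 := by linarith
    simp only [div_eq_zero_iff, mul_eq_zero, hA.ne', h.ne', hβ.ne', hq0.ne', or_false, false_or,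
      pow_eq_zero_iff, ne_eq, OfNat.ofNat_ne_zero, not_false_eq_true] at e1 e2 e3
    have hb : b = 0 := (pow_eq_zero_iff two_ne_zero).1
      (by linarith [sq_nonneg (a - J), sq_nonneg b])
    have haJ : a = J := sub_eq_zero.1 ((pow_eq_zero_iff two_ne_zero).1
      (by linarith [sq_nonneg (a - J), sq_nonneg b]))
    subst hb
    have haq : a = q := by
      have : a * (a - q) = 0 := by rw [← haJ] at e2; linarith
      rcases mul_eq_zero.1 this with h' | h'
      · linarith
      · linarith
    have hane : a ≠ 0 := by linarith
    refine ⟨haq, rfl, ?_, ?_⟩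
    · have : a * c = 0 := by linarith
      exact (mul_eq_zero.1 this).resolve_left hane
    · have : a * (d - 1) = 0 := by linarith
      linarith [(mul_eq_zero.1 this).resolve_left hane]
  · obtain ⟨rfl, rfl, rfl, rfl⟩ := eq_zero_of_finite_distortion h0 h hk
    have hdist : matDistortion 0 0 0 0 = 2 := by simp [matDistortion]
    have key : 2 - (q + q⁻¹) - (1 - (q ^ 2)⁻¹) * (2 * 0 - (0 * 0 - 0 * 0) - q)
        = 2 * (q - 1) / q := by
      field_simp; ring
    have hpos : 0 < 2 * (q - 1) / q := div_pos (by linarith) hq0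
    rw [hdist]
    exact ⟨by linarith, fun heq => by linarith⟩

/-- Compression in the `x`-direction: for `q < 1` the distortion dominates its value at the diagonal
matrix `diag (q, 1)` plus a multiple of an affine function of the null Lagrangians `d` and
`a * d - b * c`, with equality only at `diag (q, 1)`. -/
lemma matDistortion_lower_of_lt_one {a b c d k q : ℝ} (hq0 : 0 < q) (hq : q < 1)
    (h0 : 0 ≤ a * d - b * c)
    (hk : a ^ 2 + b ^ 2 + (c ^ 2 + d ^ 2) ≤ k * (a * d - b * c)) :
    ((q ^ 2)⁻¹ - 1) * (2 * q * d - (a * d - b * c) - q) ≤ matDistortion a b c d - (q + q⁻¹) ∧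
    (((q ^ 2)⁻¹ - 1) * (2 * q * d - (a * d - b * c) - q) = matDistortion a b c d - (q + q⁻¹) →
      a = q ∧ b = 0 ∧ c = 0 ∧ d = 1) := by
  have hβ : 0 < (q ^ 2)⁻¹ - 1 := by
    have : 1 < (q ^ 2)⁻¹ := (one_lt_inv₀ (by positivity)).2 (by nlinarith)
    linarith
  by_cases h : 0 < a * d - b * c
  · have hdist : matDistortion a b c d = (a ^ 2 + b ^ 2 + (c ^ 2 + d ^ 2)) / (a * d - b * c) := by
      simp [matDistortion, h]
    obtain ⟨J, hJ⟩ : ∃ J, J = a * d - b * c := ⟨_, rfl⟩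
    rw [← hJ] at h hdist ⊢
    have hB : 0 < c ^ 2 + d ^ 2 := by
      by_contra hcon
      have hc : c = 0 := (pow_eq_zero_iff two_ne_zero).1
        (by linarith [sq_nonneg c, sq_nonneg d])
      have hd : d = 0 := (pow_eq_zero_iff two_ne_zero).1
        (by linarith [sq_nonneg c, sq_nonneg d])
      simp [hc, hd] at hJ
      linarith
    -- Lagrange's identity again, now with the ratio `(c ^ 2 + d ^ 2) / J`.
    have hA : a ^ 2 + b ^ 2 = (J ^ 2 + (a * c + b * d) ^ 2) / (c ^ 2 + d ^ 2) := by
      rw [eq_div_iff hB.ne', hJ]; ring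
    have key : matDistortion a b c d - (q + q⁻¹) - ((q ^ 2)⁻¹ - 1) * (2 * q * d - J - q) =
        (a * c + b * d) ^ 2 / ((c ^ 2 + d ^ 2) * J)
        + (q * (c ^ 2 + d ^ 2) - J) ^ 2 / ((c ^ 2 + d ^ 2) * J)
        + ((q ^ 2)⁻¹ - 1) * (((q * d - J) ^ 2 + q ^ 2 * c ^ 2) / J) := by
      rw [hdist, hA]
      field_simp
      ring
    have t1 : 0 ≤ (a * c + b * d) ^ 2 / ((c ^ 2 + d ^ 2) * J) := by positivity
    have t2 : 0 ≤ (q * (c ^ 2 + d ^ 2) - J) ^ 2 / ((c ^ 2 + d ^ 2) * J) := by positivity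
    have t3 : 0 ≤ ((q ^ 2)⁻¹ - 1) * (((q * d - J) ^ 2 + q ^ 2 * c ^ 2) / J) := by positivity
    refine ⟨by linarith, fun heq => ?_⟩
    have e1 : (a * c + b * d) ^ 2 / ((c ^ 2 + d ^ 2) * J) = 0 := by linarith
    have e2 : (q * (c ^ 2 + d ^ 2) - J) ^ 2 / ((c ^ 2 + d ^ 2) * J) = 0 := by linarith
    have e3 : ((q ^ 2)⁻¹ - 1) * (((q * d - J) ^ 2 + q ^ 2 * c ^ 2) / J) = 0 := by linarith
    simp only [div_eq_zero_iff, mul_eq_zero, hB.ne', h.ne', hβ.ne', or_false, false_or,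
      pow_eq_zero_iff, ne_eq, OfNat.ofNat_ne_zero, not_false_eq_true] at e1 e2 e3
    have hc : c = 0 := by
      have : q ^ 2 * c ^ 2 = 0 := by
        linarith [sq_nonneg (q * d - J), mul_nonneg (sq_nonneg q) (sq_nonneg c)]
      simpa [hq0.ne'] using this
    subst hc
    have hdJ : q * d = J := sub_eq_zero.1 ((pow_eq_zero_iff two_ne_zero).1
      (by linarith [sq_nonneg (q * d - J)]))
    have hdne : d ≠ 0 := by
      rintro rfl
      simp at hB
    have hd1 : d = 1 := by
      have : q * d * (d - 1) = 0 := by rw [← hdJ] at e2; linarith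
      rcases mul_eq_zero.1 this with h' | h'
      · exact absurd h' (mul_ne_zero hq0.ne' hdne)
      · linarith
    subst hd1
    refine ⟨by linarith, by linarith, rfl, rfl⟩
  · obtain ⟨rfl, rfl, rfl, rfl⟩ := eq_zero_of_finite_distortion h0 h hk
    have hdist : matDistortion 0 0 0 0 = 2 := by simp [matDistortion]
    have key : 2 - (q + q⁻¹) - ((q ^ 2)⁻¹ - 1) * (2 * q * 0 - (0 * 0 - 0 * 0) - q)
        = 2 * (1 - q) := by
      field_simp; ring
    have hpos : 0 < 2 * (1 - q) := by linarith
    rw [hdist]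
    exact ⟨by linarith, fun heq => by linarith⟩

end Pointwise

/-! ### Absolute continuity on lines -/

section ACL

lemma integrable_smul_of_tsupport_subset {V : Type*} [NormedAddCommGroup V] [NormedSpace ℝ V]
    [FiniteDimensional ℝ V] [MeasureSpace V] [BorelSpace V] {Ω : Set V} {g : V → ℂ}
    (hg : LocallyIntegrableOn g Ω) {η : V → ℝ} (hη : Continuous η) (hηc : HasCompactSupport η)
    (hηΩ : tsupport η ⊆ Ω) : Integrable fun z => η z • g z :=
  (integrableOn_iff_integrable_of_support_subset
    ((Function.support_smul_subset_left _ _).trans (subset_tsupport η))).1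
    ((hg.integrableOn_compact_subset hηΩ hηc).continuousOn_smul hη.continuousOn hηc)

/-- A smooth approximation of the indicator function of `(t₁, t₂]`, to which it tends pointwise as
`δ → 0⁺`. -/
noncomputable def smoothStep (t₁ t₂ δ t : ℝ) : ℝ :=
  Real.smoothTransition ((t - t₁) / δ) - Real.smoothTransition ((t - t₂) / δ)

lemma contDiff_smoothStep (t₁ t₂ δ : ℝ) : ContDiff ℝ ∞ (smoothStep t₁ t₂ δ) := by
  unfold smoothStep
  exact (Real.smoothTransition.contDiff.comp ((contDiff_id.sub contDiff_const).div_const _)).sub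
    (Real.smoothTransition.contDiff.comp ((contDiff_id.sub contDiff_const).div_const _))

lemma abs_smoothStep_le (t₁ t₂ δ t : ℝ) : |smoothStep t₁ t₂ δ t| ≤ 1 := by
  unfold smoothStep
  have := Real.smoothTransition.nonneg ((t - t₁) / δ)
  have := Real.smoothTransition.nonneg ((t - t₂) / δ)
  have := Real.smoothTransition.le_one ((t - t₁) / δ)
  have := Real.smoothTransition.le_one ((t - t₂) / δ)
  rw [abs_le]; constructor <;> linarith

lemma smoothStep_eq_zero {t₁ t₂ δ t : ℝ} (h12 : t₁ ≤ t₂) (hδ : 0 < δ)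
    (ht : t ∉ Icc t₁ (t₂ + δ)) : smoothStep t₁ t₂ δ t = 0 := by
  unfold smoothStep
  rw [mem_Icc, not_and_or, not_le, not_le] at ht
  rcases ht with ht | ht
  · rw [Real.smoothTransition.zero_of_nonpos, Real.smoothTransition.zero_of_nonpos, sub_zero]
    · exact div_nonpos_of_nonpos_of_nonneg (by linarith) hδ.le
    · exact div_nonpos_of_nonpos_of_nonneg (by linarith) hδ.le
  · rw [Real.smoothTransition.one_of_one_le, Real.smoothTransition.one_of_one_le, sub_self]
    · rw [le_div_iff₀ hδ]; linarith
    · rw [le_div_iff₀ hδ]; linarith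

lemma tsupport_smoothStep_subset {t₁ t₂ δ : ℝ} (h12 : t₁ ≤ t₂) (hδ : 0 < δ) :
    tsupport (smoothStep t₁ t₂ δ) ⊆ Icc t₁ (t₂ + δ) :=
  closure_minimal (fun _ ht => by_contra fun h => ht (smoothStep_eq_zero h12 hδ h)) isClosed_Icc

lemma tendsto_smoothTransition_div (a t : ℝ) :
    Tendsto (fun δ => Real.smoothTransition ((t - a) / δ)) (𝓝[>] 0)
      (𝓝 ((Ioi a).indicator (fun _ => (1 : ℝ)) t)) := by
  by_cases h : t ∈ Ioi a
  · rw [indicator_of_mem h]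
    refine tendsto_const_nhds.congr' ?_
    have hpos : 0 < t - a := sub_pos.2 h
    filter_upwards [Ioo_mem_nhdsGT hpos] with δ hδ
    rw [Real.smoothTransition.one_of_one_le]
    rw [le_div_iff₀ hδ.1]
    linarith [hδ.2]
  · rw [indicator_of_notMem h]
    refine tendsto_const_nhds.congr' ?_
    filter_upwards [self_mem_nhdsWithin] with δ hδ
    rw [Real.smoothTransition.zero_of_nonpos]
    exact div_nonpos_of_nonpos_of_nonneg (sub_nonpos.2 (not_lt.1 h)) (mem_Ioi.1 hδ).le

lemma tendsto_smoothStep {t₁ t₂ : ℝ} (h12 : t₁ ≤ t₂) (t : ℝ) :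
    Tendsto (fun δ => smoothStep t₁ t₂ δ t) (𝓝[>] 0)
      (𝓝 ((Ioc t₁ t₂).indicator (fun _ => (1 : ℝ)) t)) := by
  have h := (tendsto_smoothTransition_div t₁ t).sub (tendsto_smoothTransition_div t₂ t)
  have he : (Ioi t₁).indicator (fun _ => (1 : ℝ)) t - (Ioi t₂).indicator (fun _ => (1 : ℝ)) t =
      (Ioc t₁ t₂).indicator (fun _ => (1 : ℝ)) t := by
    simp only [indicator_apply, mem_Ioc, mem_Ioi]
    by_cases h1 : t₁ < t <;> by_cases h2 : t₂ < t <;> grind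
  rwa [he] at h

lemma deriv_smoothTransition_eq_zero {t : ℝ} (ht : t ∉ Icc (0 : ℝ) 1) :
    deriv Real.smoothTransition t = 0 := by
  rw [mem_Icc, not_and_or, not_le, not_le] at ht
  rcases ht with ht | ht
  · have : Real.smoothTransition =ᶠ[𝓝 t] fun _ => 0 := by
      filter_upwards [Iio_mem_nhds ht] with s hs
      exact Real.smoothTransition.zero_of_nonpos (mem_Iio.1 hs).le
    rw [this.deriv_eq]; simp
  · have : Real.smoothTransition =ᶠ[𝓝 t] fun _ => 1 := by
      filter_upwards [Ioi_mem_nhds ht] with s hs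
      exact Real.smoothTransition.one_of_one_le (mem_Ioi.1 hs).le
    rw [this.deriv_eq]; simp

lemma continuous_deriv_smoothTransition : Continuous (deriv Real.smoothTransition) :=
  (Real.smoothTransition.contDiff (n := 1)).continuous_deriv (by simp)

lemma differentiable_smoothTransition : Differentiable ℝ Real.smoothTransition :=
  (Real.smoothTransition.contDiff (n := 1)).differentiable (by simp)

lemma hasDerivAt_smoothTransition_div (a δ t : ℝ) :
    HasDerivAt (fun t => Real.smoothTransition ((t - a) / δ))
      (deriv Real.smoothTransition ((t - a) / δ) * δ⁻¹) t := by
  have h1 : HasDerivAt (fun t => (t - a) / δ) (δ⁻¹) t := by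
    simpa using ((hasDerivAt_id t).sub_const a).div_const δ
  exact (differentiable_smoothTransition ((t - a) / δ)).hasDerivAt.comp t h1

lemma deriv_smoothStep (t₁ t₂ δ t : ℝ) : deriv (smoothStep t₁ t₂ δ) t =
    deriv Real.smoothTransition ((t - t₁) / δ) * δ⁻¹ -
      deriv Real.smoothTransition ((t - t₂) / δ) * δ⁻¹ :=
  ((hasDerivAt_smoothTransition_div t₁ δ t).sub (hasDerivAt_smoothTransition_div t₂ δ t)).deriv

lemma integral_deriv_smoothTransition_smul (c : ℝ → ℂ) (a : ℝ) {δ : ℝ} (hδ : 0 < δ) :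
    ∫ t, (deriv Real.smoothTransition ((t - a) / δ) * δ⁻¹) • c t =
      ∫ τ in Icc (0 : ℝ) 1, deriv Real.smoothTransition τ • c (a + δ * τ) := by
  have h1 : ∀ t, (deriv Real.smoothTransition ((t - a) / δ) * δ⁻¹) • c t =
      (fun τ => δ⁻¹ • (deriv Real.smoothTransition τ • c (a + δ * τ))) ((t - a) / δ) := by
    intro t
    have : a + δ * ((t - a) / δ) = t := by field_simp; ring
    simp only [this, smul_smul]
    rw [mul_comm]
  rw [integral_congr_ae (ae_of_all _ h1),
    integral_sub_right_eq_self (fun t => (fun τ => δ⁻¹ • (deriv Real.smoothTransition τ •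
      c (a + δ * τ))) (t / δ)) a,
    Measure.integral_comp_div (fun τ => δ⁻¹ • (deriv Real.smoothTransition τ • c (a + δ * τ))),
    integral_smul, smul_smul, abs_of_pos hδ, mul_inv_cancel₀ hδ.ne', one_smul,
    setIntegral_eq_integral_of_forall_compl_eq_zero]
  intro τ hτ
  rw [deriv_smoothTransition_eq_zero hτ, zero_smul]

lemma tendsto_integral_deriv_smoothTransition_smul {c : ℝ → ℂ} (hc : Continuous c) (a : ℝ) :
    Tendsto (fun δ => ∫ t, (deriv Real.smoothTransition ((t - a) / δ) * δ⁻¹) • c t) (𝓝[>] 0)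
      (𝓝 (c a)) := by
  have hcont : Continuous fun δ : ℝ =>
      ∫ τ in Icc (0 : ℝ) 1, deriv Real.smoothTransition τ • c (a + δ * τ) := by
    refine continuous_parametric_integral_of_continuous
      (f := fun δ τ : ℝ => deriv Real.smoothTransition τ • c (a + δ * τ)) ?_ isCompact_Icc
    have := continuous_deriv_smoothTransition
    fun_prop
  have h0 : ∫ τ in Icc (0 : ℝ) 1, deriv Real.smoothTransition τ • c (a + 0 * τ) = c a := by
    simp only [zero_mul, add_zero]
    rw [integral_smul_const, integral_Icc_eq_integral_Ioc, ← intervalIntegral.integral_of_le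
      zero_le_one, intervalIntegral.integral_deriv_eq_sub
        (fun x _ => differentiable_smoothTransition x)
        (continuous_deriv_smoothTransition.intervalIntegrable _ _)]
    simp
  have h := (hcont.tendsto 0).mono_left (nhdsWithin_le_nhds (s := Ioi 0))
  rw [h0] at h
  refine h.congr' ?_
  filter_upwards [self_mem_nhdsWithin] with δ hδ
  exact (integral_deriv_smoothTransition_smul c a hδ).symm

lemma tendsto_integral_deriv_smoothStep_smul {c : ℝ → ℂ} (hc : Continuous c) (t₁ t₂ : ℝ) :
    Tendsto (fun δ => ∫ t, deriv (smoothStep t₁ t₂ δ) t • c t) (𝓝[>] 0) (𝓝 (c t₁ - c t₂)) := by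
  refine ((tendsto_integral_deriv_smoothTransition_smul hc t₁).sub
    (tendsto_integral_deriv_smoothTransition_smul hc t₂)).congr' ?_
  filter_upwards [self_mem_nhdsWithin] with δ (hδ : 0 < δ)
  have hint : ∀ a, Integrable fun t =>
      (deriv Real.smoothTransition ((t - a) / δ) * δ⁻¹) • c t := fun a => by
    refine Continuous.integrable_of_hasCompactSupport ?_ ?_
    · have := continuous_deriv_smoothTransition
      fun_prop
    · refine HasCompactSupport.intro (isCompact_Icc (a := a) (b := a + δ)) fun t ht => ?_
      rw [deriv_smoothTransition_eq_zero, zero_mul, zero_smul]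
      contrapose! ht
      rw [mem_Icc, le_div_iff₀ hδ, div_le_iff₀ hδ] at ht
      constructor <;> linarith [ht.1, ht.2]
  rw [← integral_sub (hint t₁) (hint t₂)]
  simp_rw [deriv_smoothStep, sub_smul]

variable {A B : ℝ} {F H : ℝ × ℝ → ℂ}

/-- `H` is a weak derivative of `F` in the second variable on `(0, A) × (0, B)`, tested against
products. -/
def IsWeakPartialSnd (A B : ℝ) (F H : ℝ × ℝ → ℂ) : Prop :=
  ∀ θ ψ : ℝ → ℝ, ContDiff ℝ ∞ θ → HasCompactSupport θ → tsupport θ ⊆ Ioo 0 A →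
    ContDiff ℝ ∞ ψ → HasCompactSupport ψ → tsupport ψ ⊆ Ioo 0 B →
    ∫ z, (θ z.1 * deriv ψ z.2) • F z = - ∫ z, (θ z.1 * ψ z.2) • H z

lemma integrableOn_prod_of_compact (hH : LocallyIntegrableOn H (Ioo 0 A ×ˢ Ioo 0 B))
    {K : Set ℝ} (hK : IsCompact K) (hKA : K ⊆ Ioo 0 A) {a b : ℝ} (ha : 0 < a) (hb : b < B) :
    IntegrableOn H (K ×ˢ Icc a b) :=
  hH.integrableOn_compact_subset (prod_mono hKA (Icc_subset_Ioo ha hb)) (hK.prod isCompact_Icc)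

/-- The integral form of `F (s, t₂) - F (s, t₁) = ∫ H (s, t) dt`: the second factor of a product test
function tends to the indicator function of `(t₁, t₂]`, so that its derivative tends to a difference
of two Dirac measures. -/
lemma IsWeakPartialSnd.integral_smul_sub (hF : Continuous F)
    (hH : LocallyIntegrableOn H (Ioo 0 A ×ˢ Ioo 0 B)) (hw : IsWeakPartialSnd A B F H)
    {t₁ t₂ : ℝ} (h1 : 0 < t₁) (h12 : t₁ ≤ t₂) (h2 : t₂ < B)
    {θ : ℝ → ℝ} (hθ : ContDiff ℝ ∞ θ) (hθc : HasCompactSupport θ) (hθA : tsupport θ ⊆ Ioo 0 A) :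
    (∫ s, θ s • F (s, t₁)) - ∫ s, θ s • F (s, t₂) =
      - ∫ s, θ s • ∫ t in Ioc t₁ t₂, H (s, t) := by
  obtain ⟨t₃, h23, h3⟩ := exists_between h2
  have hθcont := hθ.continuous
  set c : ℝ → ℂ := fun t => ∫ s, θ s • F (s, t) with hc
  have hcc : Continuous c := by
    have hc' : c = fun t => ∫ s in tsupport θ, θ s • F (s, t) := by
      funext t
      rw [setIntegral_eq_integral_of_forall_compl_eq_zero]
      intro s hs
      rw [image_eq_zero_of_notMem_tsupport hs, zero_smul]
    rw [hc']
    refine continuous_parametric_integral_of_continuous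
      (f := fun t s : ℝ => θ s • F (s, t)) ?_ hθc
    fun_prop
  have hsmall : ∀ᶠ δ in 𝓝[>] (0 : ℝ), δ ∈ Ioo 0 (t₃ - t₂) := Ioo_mem_nhdsGT (sub_pos.2 h23)
  have hlhs : ∀ᶠ δ in 𝓝[>] (0 : ℝ), ∫ t, deriv (smoothStep t₁ t₂ δ) t • c t =
      - ∫ z : ℝ × ℝ, (θ z.1 * smoothStep t₁ t₂ δ z.2) • H z := by
    filter_upwards [hsmall] with δ hδ
    have hsup := tsupport_smoothStep_subset h12 hδ.1
    have hcs : HasCompactSupport (smoothStep t₁ t₂ δ) :=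
      HasCompactSupport.of_support_subset_isCompact isCompact_Icc ((subset_tsupport _).trans hsup)
    rw [← hw θ (smoothStep t₁ t₂ δ) hθ hθc hθA (contDiff_smoothStep _ _ _) hcs
      (hsup.trans (Icc_subset_Ioo h1 (by linarith [hδ.2])))]
    have hdc : Continuous (deriv (smoothStep t₁ t₂ δ)) :=
      (contDiff_smoothStep t₁ t₂ δ).continuous_deriv (by simp)
    have hint : Integrable fun z : ℝ × ℝ => (θ z.1 * deriv (smoothStep t₁ t₂ δ) z.2) • F z := by
      refine Continuous.integrable_of_hasCompactSupport (by fun_prop) ?_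
      refine HasCompactSupport.intro (hθc.isCompact.prod hcs.deriv.isCompact) fun z hz => ?_
      rw [mem_prod, not_and_or] at hz
      rcases hz with hz | hz <;> simp [image_eq_zero_of_notMem_tsupport hz]
    rw [Measure.volume_eq_prod, integral_prod_symm _ hint]
    refine integral_congr_ae (ae_of_all _ fun t => ?_)
    simp only [hc]
    rw [← integral_smul]
    refine integral_congr_ae (ae_of_all _ fun s => ?_)
    simp only [smul_smul]
    rw [mul_comm]
  have hlim1 := (tendsto_integral_deriv_smoothStep_smul hcc t₁ t₂).congr' hlhs
  have hHint : Integrable ((tsupport θ ×ˢ Icc t₁ t₃).indicator H) :=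
    (integrableOn_prod_of_compact hH hθc hθA h1 h3).integrable_indicator
      (hθc.isCompact.measurableSet.prod measurableSet_Icc)
  obtain ⟨C, hC⟩ := hθcont.bounded_above_of_compact_support hθc
  have hC0 : 0 ≤ C := (norm_nonneg _).trans (hC 0)
  have hcut : ∀ k : ℝ → ℝ, (∀ t, t ∉ Icc t₁ t₃ → k t = 0) → ∀ z : ℝ × ℝ,
      (θ z.1 * k z.2) • H z = (θ z.1 * k z.2) • (tsupport θ ×ˢ Icc t₁ t₃).indicator H z := by
    intro k hk z
    by_cases hz : z ∈ tsupport θ ×ˢ Icc t₁ t₃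
    · rw [indicator_of_mem hz]
    · rw [mem_prod, not_and_or] at hz
      rcases hz with hz | hz
      · simp [image_eq_zero_of_notMem_tsupport hz]
      · simp [hk _ hz]
  have hlim2 : Tendsto (fun δ => - ∫ z : ℝ × ℝ, (θ z.1 * smoothStep t₁ t₂ δ z.2) • H z) (𝓝[>] 0)
      (𝓝 (- ∫ z : ℝ × ℝ, (θ z.1 * (Ioc t₁ t₂).indicator (fun _ => (1 : ℝ)) z.2) • H z)) := by
    refine Tendsto.neg (tendsto_integral_filter_of_dominated_convergence
      (fun z => C * ‖(tsupport θ ×ˢ Icc t₁ t₃).indicator H z‖) ?_ ?_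
      (hHint.norm.const_mul C) ?_)
    · filter_upwards [hsmall] with δ hδ
      rw [funext (hcut _ fun t ht => smoothStep_eq_zero h12 hδ.1 fun h =>
        ht ⟨h.1, h.2.trans (by linarith [hδ.2])⟩)]
      have := (contDiff_smoothStep t₁ t₂ δ).continuous
      have hcont : Continuous fun z : ℝ × ℝ => θ z.1 * smoothStep t₁ t₂ δ z.2 := by fun_prop
      exact hcont.aestronglyMeasurable.smul hHint.aestronglyMeasurable
    · filter_upwards [hsmall] with δ hδ
      refine ae_of_all _ fun z => ?_
      rw [hcut _ fun t ht => smoothStep_eq_zero h12 hδ.1 fun h =>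
        ht ⟨h.1, h.2.trans (by linarith [hδ.2])⟩, norm_smul, norm_mul]
      have h1 := abs_smoothStep_le t₁ t₂ δ z.2
      rw [← Real.norm_eq_abs] at h1
      gcongr
      calc _ ≤ C * 1 := by gcongr; exact hC _
        _ = C := mul_one C
    · refine ae_of_all _ fun z => ?_
      exact ((tendsto_const_nhds.mul (tendsto_smoothStep h12 z.2))).smul_const _
  rw [tendsto_nhds_unique hlim1 hlim2, neg_inj]
  have hk : ∀ t, t ∉ Icc t₁ t₃ → (Ioc t₁ t₂).indicator (fun _ => (1 : ℝ)) t = 0 := fun t ht =>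
    indicator_of_notMem (fun h => ht ⟨h.1.le, h.2.trans h23.le⟩) _
  have hint : Integrable fun z : ℝ × ℝ =>
      (θ z.1 * (Ioc t₁ t₂).indicator (fun _ => (1 : ℝ)) z.2) • H z := by
    rw [funext (hcut _ hk)]
    refine Integrable.bdd_smul
      (φ := fun z : ℝ × ℝ => θ z.1 * (Ioc t₁ t₂).indicator (fun _ => (1 : ℝ)) z.2)
      hHint C (Measurable.aestronglyMeasurable ?_) (ae_of_all _ fun z => ?_)
    · exact (hθcont.measurable.comp measurable_fst).mul
        ((measurable_const.indicator measurableSet_Ioc).comp measurable_snd)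
    · rw [norm_mul]
      calc _ ≤ C * 1 := by
            gcongr
            · exact hC _
            · simp only [indicator_apply]; split_ifs <;> simp
        _ = C := mul_one C
  rw [Measure.volume_eq_prod, integral_prod _ hint]
  refine integral_congr_ae (ae_of_all _ fun s => ?_)
  simp only
  rw [← integral_smul, ← integral_indicator measurableSet_Ioc]
  refine integral_congr_ae (ae_of_all _ fun t => ?_)
  simp only [indicator_apply]
  split_ifs <;> simp

lemma locallyIntegrableOn_integral_Ioc (hH : LocallyIntegrableOn H (Ioo 0 A ×ˢ Ioo 0 B))
    {t₁ t₂ : ℝ} (h1 : 0 < t₁) (h2 : t₂ < B) :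
    LocallyIntegrableOn (fun s => ∫ t in Ioc t₁ t₂, H (s, t)) (Ioo 0 A) := by
  rw [locallyIntegrableOn_iff isOpen_Ioo.isLocallyClosed]
  intro K hKA hK
  have h := (integrableOn_prod_of_compact hH hK hKA h1 h2).mono_set
    (prod_mono le_rfl (Ioc_subset_Icc_self (a := t₁) (b := t₂)))
  rw [IntegrableOn, Measure.volume_eq_prod, ← Measure.prod_restrict] at h
  exact h.integral_prod_left

lemma IsWeakPartialSnd.ae_sub_eq (hF : Continuous F)
    (hH : LocallyIntegrableOn H (Ioo 0 A ×ˢ Ioo 0 B)) (hw : IsWeakPartialSnd A B F H)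
    {t₁ t₂ : ℝ} (h1 : 0 < t₁) (h12 : t₁ ≤ t₂) (h2 : t₂ < B) :
    ∀ᵐ s, s ∈ Ioo 0 A → F (s, t₂) - F (s, t₁) = ∫ t in Ioc t₁ t₂, H (s, t) := by
  have hloc1 : LocallyIntegrableOn (fun s => F (s, t₂) - F (s, t₁)) (Ioo 0 A) :=
    (Continuous.locallyIntegrable (by fun_prop)).locallyIntegrableOn _
  have hloc2 := locallyIntegrableOn_integral_Ioc hH h1 h2
  have key := isOpen_Ioo.ae_eq_zero_of_integral_contDiff_smul_eq_zero (hloc1.sub hloc2) ?_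
  · filter_upwards [key] with s hs hsA
    exact sub_eq_zero.1 (hs hsA)
  intro θ hθ hθc hθA
  have hcont := hθ.continuous
  have hi : ∀ t, Integrable fun s => θ s • F (s, t) := fun t =>
    Continuous.integrable_of_hasCompactSupport (by fun_prop) hθc.smul_right
  have hi2 : Integrable fun s => θ s • ∫ t in Ioc t₁ t₂, H (s, t) :=
    integrable_smul_of_tsupport_subset hloc2 hcont hθc hθA
  have := hw.integral_smul_sub hF hH h1 h12 h2 hθ hθc hθA
  simp only [Pi.sub_apply, smul_sub]
  have hsub := (hi t₂).sub (hi t₁)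
  simp only [Pi.sub_def] at hsub
  rw [integral_sub hsub hi2, integral_sub (hi _) (hi _)]
  linear_combination -this

/-- The exceptional null set is chosen independently of the interval by exhausting the box with
rational ones. -/
lemma ae_integrableOn_slice (hH : LocallyIntegrableOn H (Ioo 0 A ×ˢ Ioo 0 B)) :
    ∀ᵐ s, s ∈ Ioo 0 A → ∀ a b, 0 < a → b < B → IntegrableOn (fun t => H (s, t)) (Icc a b) := by
  have key : ∀ q r a b : ℚ, ∀ᵐ s : ℝ, 0 < (q : ℝ) → (r : ℝ) < A → 0 < (a : ℝ) → (b : ℝ) < B →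
      s ∈ Icc (q : ℝ) r → IntegrableOn (fun t => H (s, t)) (Icc (a : ℝ) b) := by
    intro q r a b
    by_cases h : 0 < (q : ℝ) ∧ (r : ℝ) < A ∧ 0 < (a : ℝ) ∧ (b : ℝ) < B
    · have hi := integrableOn_prod_of_compact hH (isCompact_Icc (a := (q : ℝ)) (b := r))
        (Icc_subset_Ioo h.1 h.2.1) h.2.2.1 h.2.2.2
      rw [IntegrableOn, Measure.volume_eq_prod, ← Measure.prod_restrict] at hi
      filter_upwards [(ae_restrict_iff' measurableSet_Icc).1 hi.prod_right_ae] with s hs _ _ _ _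
      exact hs
    · refine ae_of_all _ fun s h1 h2 h3 h4 => absurd ⟨h1, h2, h3, h4⟩ h
  simp only [← ae_all_iff] at key
  filter_upwards [key] with s hs hsA a b ha hb
  obtain ⟨q, hq0, hq⟩ := exists_rat_btwn hsA.1
  obtain ⟨r, hr, hrA⟩ := exists_rat_btwn hsA.2
  obtain ⟨a', ha0, ha'⟩ := exists_rat_btwn ha
  obtain ⟨b', hb', hbB⟩ := exists_rat_btwn hb
  exact (hs q r a' b' (by exact_mod_cast hq0) hrA (by exact_mod_cast ha0) hbB ⟨hq.le, hr.le⟩).mono_set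
    (Icc_subset_Icc ha'.le hb'.le)

/-- A continuous function with a weak derivative is absolutely continuous on almost every line. -/
theorem IsWeakPartialSnd.ae_forall_sub_eq (hF : Continuous F)
    (hH : LocallyIntegrableOn H (Ioo 0 A ×ˢ Ioo 0 B)) (hw : IsWeakPartialSnd A B F H) :
    ∀ᵐ s, s ∈ Ioo 0 A → ∀ a b, 0 < a → a ≤ b → b < B →
      IntervalIntegrable (fun t => H (s, t)) volume a b ∧
      F (s, b) - F (s, a) = ∫ t in a..b, H (s, t) := by
  have key : ∀ q r : ℚ, ∀ᵐ s : ℝ, 0 < (q : ℝ) → (q : ℝ) ≤ r → (r : ℝ) < B →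
      s ∈ Ioo 0 A → F (s, r) - F (s, q) = ∫ t in Ioc (q : ℝ) r, H (s, t) := by
    intro q r
    by_cases h : 0 < (q : ℝ) ∧ (q : ℝ) ≤ r ∧ (r : ℝ) < B
    · filter_upwards [hw.ae_sub_eq hF hH h.1 h.2.1 h.2.2] with s hs _ _ _
      exact hs
    · exact ae_of_all _ fun s h1 h2 h3 => absurd ⟨h1, h2, h3⟩ h
  simp only [← ae_all_iff] at key
  filter_upwards [key, ae_integrableOn_slice hH] with s hs hi hsA a b ha hab hb
  have hii : ∀ a b, 0 < a → a ≤ b → b < B → IntervalIntegrable (fun t => H (s, t)) volume a b :=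
    fun a b ha hab hb => (intervalIntegrable_iff_integrableOn_Icc_of_le hab).2 (hi hsA a b ha hb)
  refine ⟨hii a b ha hab hb, ?_⟩
  obtain ⟨q, hq0, hqa⟩ := exists_rat_btwn ha
  obtain ⟨r, hbr, hrB⟩ := exists_rat_btwn hb
  have hq0' : (0 : ℝ) < q := by exact_mod_cast hq0
  have hqr : (q : ℝ) ≤ r := by linarith
  have hFs : Continuous fun t => F (s, t) := by fun_prop
  -- Both sides are continuous in `t` and agree at rational points.
  have heq : EqOn (fun t => F (s, t) - F (s, q)) (fun t => ∫ τ in (q : ℝ)..t, H (s, τ))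
      (Ioo (q : ℝ) r) := by
    have hd : Dense (range ((↑) : ℚ → ℝ)) := Rat.denseRange_cast
    refine EqOn.of_subset_closure (s := Ioo (q : ℝ) r ∩ range ((↑) : ℚ → ℝ)) ?_ ?_ ?_
      inter_subset_left (hd.open_subset_closure_inter isOpen_Ioo)
    · rintro _ ⟨ht, t, rfl⟩
      simp only
      rw [intervalIntegral.integral_of_le ht.1.le]
      exact hs q t hq0' ht.1.le (ht.2.trans hrB) hsA
    · exact (hFs.sub continuous_const).continuousOn
    · refine (intervalIntegral.continuousOn_primitive_interval
        (a := (q : ℝ)) (b := (r : ℝ)) ?_).mono ?_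
      · rw [uIcc_of_le hqr]; exact hi hsA _ _ hq0' hrB
      · rw [uIcc_of_le hqr]; exact Ioo_subset_Icc_self
  have ea := heq ⟨hqa, by linarith⟩
  have eb := heq ⟨by linarith, hbr⟩
  simp only at ea eb
  rw [← intervalIntegral.integral_interval_sub_left (hii q b hq0' (by linarith) hb)
    (hii q a hq0' hqa.le (by linarith)), ← ea, ← eb]
  ring

/-- Weak derivatives of continuous functions are classical derivatives almost everywhere. -/
theorem IsWeakPartialSnd.ae_hasDerivAt (hF : Continuous F)
    (hH : LocallyIntegrableOn H (Ioo 0 A ×ˢ Ioo 0 B)) (hw : IsWeakPartialSnd A B F H) :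
    ∀ᵐ z : ℝ × ℝ, z ∈ Ioo 0 A ×ˢ Ioo 0 B → HasDerivAt (fun t => F (z.1, t)) (H z) z.2 := by
  set f : ℝ → ℝ → ℂ := fun s t => F (s, t) with hf
  have hfu : Continuous f.uncurry := hF
  set ρ := (volume.restrict (Ioo 0 A)).prod (volume.restrict (Ioo 0 B)) with hρ
  have hρ' : ρ = volume.restrict (Ioo 0 A ×ˢ Ioo 0 B) := by
    rw [hρ, Measure.prod_restrict, Measure.volume_eq_prod]
  have hHm : AEStronglyMeasurable H ρ := by
    rw [hρ']; exact hH.aestronglyMeasurable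
  rw [← ae_restrict_iff' (measurableSet_Ioo.prod measurableSet_Ioo), ← hρ']
  -- Measurability of this set allows the passage from almost every line to almost every point.
  have hmeas : MeasurableSet {p : ℝ × ℝ | DifferentiableAt ℝ (f p.1) p.2 ∧
      deriv (f p.1) p.2 = hHm.mk H p} :=
    (measurableSet_of_differentiableAt_with_param ℝ hfu).inter
      (measurableSet_eq_fun (measurable_deriv_with_param hfu) hHm.stronglyMeasurable_mk.measurable)
  have hP : ∀ᵐ p ∂ρ, DifferentiableAt ℝ (f p.1) p.2 ∧ deriv (f p.1) p.2 = hHm.mk H p := by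
    refine (Measure.ae_prod_iff_ae_ae hmeas).2 ?_
    have h1 := Measure.ae_ae_of_ae_prod hHm.ae_eq_mk
    rw [ae_restrict_iff' measurableSet_Ioo] at h1 ⊢
    filter_upwards [h1, hw.ae_forall_sub_eq hF hH] with s hs1 hs2 hsA
    have hd : ∀ᵐ t, ∀ q r : ℚ, 0 < (q : ℝ) → (r : ℝ) < B → t ∈ Ioo (q : ℝ) r →
        HasDerivAt (f s) (H (s, t)) t := by
      simp only [ae_all_iff]
      intro q r hq hr
      rcases le_total (q : ℝ) r with hqr | hqr
      · obtain ⟨hi, -⟩ := hs2 hsA q r hq hqr hr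
        filter_upwards [hi.ae_hasDerivAt_integral] with t ht htqr
        rw [uIcc_of_le hqr] at ht
        have := (ht (Ioo_subset_Icc_self htqr) q (left_mem_Icc.2 hqr)).add_const (F (s, q))
        refine this.congr_of_eventuallyEq ?_
        filter_upwards [isOpen_Ioo.mem_nhds htqr] with τ hτ
        rw [← (hs2 hsA q τ hq hτ.1.le (hτ.2.trans hr)).2]
        simp [hf]
      · exact ae_of_all _ fun t ht => absurd (ht.1.trans ht.2) (not_lt.2 hqr)
    have h2 := hs1 hsA
    rw [ae_restrict_iff' measurableSet_Ioo] at h2 ⊢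
    filter_upwards [hd, h2] with t ht h2t htB
    obtain ⟨q, hq0, hqt⟩ := exists_rat_btwn htB.1
    obtain ⟨r, htr, hrB⟩ := exists_rat_btwn htB.2
    have := ht q r (by exact_mod_cast hq0) hrB ⟨hqt, htr⟩
    exact ⟨this.differentiableAt, this.deriv.trans (h2t htB)⟩
  filter_upwards [hP, hHm.ae_eq_mk] with p hp h2
  have := hp.1.hasDerivAt
  rwa [hp.2, ← h2] at this

end ACL

/-! ### The area inequality -/

section Area

/-- The real-linear map of `ℂ` with columns `X` and `Y`. -/
noncomputable def ofColumns (X Y : ℂ) : ℂ →L[ℝ] ℂ :=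
  Complex.reCLM.smulRight X + Complex.imCLM.smulRight Y

lemma ofColumns_apply (X Y z : ℂ) : ofColumns X Y z = z.re • X + z.im • Y := rfl

lemma det_ofColumns (X Y : ℂ) : (ofColumns X Y).det = X.re * Y.im - X.im * Y.re := by
  rw [ContinuousLinearMap.det, ← LinearMap.det_toMatrix Complex.basisOneI, Matrix.det_fin_two]
  simp [LinearMap.toMatrix_apply, ofColumns_apply]
  ring

variable {g : ℂ → ℂ}

/-- The difference quotients of `g` in the direction `I` converge uniformly on `F` to `Y`. -/
def UniformLineDeriv (g Y : ℂ → ℂ) (F : Set ℂ) : Prop :=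
  ∀ ε : ℝ, 0 < ε → ∃ r : ℝ, 0 < r ∧ ∀ z ∈ F, ∀ h : ℝ, |h| < r →
    ‖g (z + h * Complex.I) - g z - h * Y z‖ ≤ ε * |h|

lemma UniformLineDeriv.continuousOn (hg : Continuous g) {Y : ℂ → ℂ} {F : Set ℂ}
    (hU : UniformLineDeriv g Y F) : ContinuousOn Y F := by
  refine continuousOn_of_uniform_approx_of_continuousOn fun u hu => ?_
  obtain ⟨ε, hε, hεu⟩ := Metric.mem_uniformity_dist.1 hu
  obtain ⟨r, hr, h⟩ := hU (ε / 2) (by positivity)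
  set k : ℝ := r / 2 with hk
  have hk0 : 0 < k := by positivity
  have hkc : (k : ℂ) ≠ 0 := by exact_mod_cast hk0.ne'
  refine ⟨fun z => (g (z + k * Complex.I) - g z) / k, ?_, fun z hz => hεu ?_⟩
  · exact Continuous.continuousOn (by fun_prop)
  · have h1 := h z hz k (by rw [abs_of_pos hk0]; linarith)
    rw [dist_comm, dist_eq_norm]
    have h2 : (g (z + k * Complex.I) - g z) / k - Y z =
        (g (z + k * Complex.I) - g z - k * Y z) / k := by field_simp
    rw [h2, norm_div, Complex.norm_real, Real.norm_eq_abs, div_lt_iff₀ (abs_pos.2 hk0.ne')]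
    have := abs_pos.2 hk0.ne'
    nlinarith

/-- If the partial derivative in the direction `1` exists at the points of `F`, and the one in the
direction `I` uniformly on `F`, then `g` is differentiable within `F`. To go from `z₀` to `z` one
moves horizontally from `z₀`, and then vertically to `z`; the corner need not be in `F`. -/
lemma UniformLineDeriv.hasFDerivWithinAt (hg : Continuous g) {Y : ℂ → ℂ} {F : Set ℂ}
    (hU : UniformLineDeriv g Y F) {z₀ X : ℂ} (hz₀ : z₀ ∈ F) (hX : HasLineDerivAt ℝ g X z₀ 1) :
    HasFDerivWithinAt g (ofColumns X (Y z₀)) F z₀ := by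
  rw [hasFDerivWithinAt_iff_isLittleO, Asymptotics.isLittleO_iff]
  intro c hc
  set ε := c / 3 with hε
  have hε0 : 0 < ε := by positivity
  obtain ⟨r, hr, hUr⟩ := hU ε hε0
  have hY := Metric.continuousWithinAt_iff.1 (hU.continuousOn hg z₀ hz₀) ε hε0
  obtain ⟨r', hr', hY⟩ := hY
  have hX' := (hasDerivAt_iff_isLittleO_nhds_zero.1 hX)
  rw [Asymptotics.isLittleO_iff] at hX'
  obtain ⟨r'', hr'', hX''⟩ := Metric.eventually_nhds_iff.1 (hX' hε0)
  have hball : Metric.ball z₀ (min r (min r' r'')) ∈ 𝓝 z₀ := Metric.ball_mem_nhds _ (by positivity)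
  filter_upwards [mem_nhdsWithin_of_mem_nhds hball, self_mem_nhdsWithin] with z hz hzF
  rw [Metric.mem_ball, lt_min_iff, lt_min_iff, dist_eq_norm] at hz
  obtain ⟨hz1, hz2, hz3⟩ := hz
  set h := (z - z₀).re with hh
  set k := (z - z₀).im with hk
  have hhn : |h| ≤ ‖z - z₀‖ := Complex.abs_re_le_norm _
  have hkn : |k| ≤ ‖z - z₀‖ := Complex.abs_im_le_norm _
  have e1 : ‖g (z - k * Complex.I) - g z + k * Y z‖ ≤ ε * |k| := by
    have := hUr z hzF (-k) (by rw [abs_neg]; linarith)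
    simpa [sub_eq_add_neg] using this
  have e2 : ‖g (z₀ + h) - g z₀ - h * X‖ ≤ ε * |h| := by
    have := hX'' (y := h) (by rw [dist_zero_right, Real.norm_eq_abs]; linarith)
    simpa using this
  have e3 : ‖Y z - Y z₀‖ ≤ ε := by
    have := hY hzF (by rw [dist_eq_norm]; exact hz2)
    rw [dist_eq_norm] at this
    exact this.le
  have hcorner : z - k * Complex.I = z₀ + h := by
    apply Complex.ext <;> simp [hh, hk]
  rw [hcorner] at e1
  have hsplit : g z - g z₀ - ofColumns X (Y z₀) (z - z₀) =
      -(g (z₀ + h) - g z + k * Y z) + (g (z₀ + h) - g z₀ - h * X) + k * (Y z - Y z₀) := by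
    rw [ofColumns_apply, ← hh, ← hk]
    simp only [Complex.real_smul]
    ring
  rw [hsplit]
  calc _ ≤ ‖g (z₀ + h) - g z + k * Y z‖ + ‖g (z₀ + h) - g z₀ - h * X‖ + ‖k * (Y z - Y z₀)‖ := by
        refine (norm_add_le _ _).trans ?_
        gcongr
        refine (norm_add_le _ _).trans ?_
        rw [norm_neg]
    _ ≤ ε * |k| + ε * |h| + |k| * ε := by
        rw [norm_mul, Complex.norm_real, Real.norm_eq_abs]
        gcongr
    _ ≤ ε * ‖z - z₀‖ + ε * ‖z - z₀‖ + ‖z - z₀‖ * ε := by gcongr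
    _ = c * ‖z - z₀‖ := by rw [hε]; ring

/-- The supremum of the errors of the difference quotients of rational step less than `1 / (n + 1)`;
the step `0` contributes `0 / 0 = 0`. -/
noncomputable def quotientError (g Y : ℂ → ℂ) (n : ℕ) (z : ℂ) : ENNReal :=
  ⨆ h : ℚ, ⨆ _ : |(h : ℝ)| < 1 / ((n : ℝ) + 1),
    ENNReal.ofReal (‖g (z + (h : ℝ) * Complex.I) - g z - (h : ℝ) * Y z‖ / |(h : ℝ)|)

lemma measurable_quotientError (hg : Continuous g) {Y : ℂ → ℂ} (hY : Measurable Y) (n : ℕ) :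
    Measurable (quotientError g Y n) := by
  refine Measurable.iSup fun h => Measurable.iSup fun _ => ?_
  refine ENNReal.measurable_ofReal.comp (Measurable.div_const (Measurable.norm ?_) _)
  have h1 : Measurable fun z => g (z + (h : ℝ) * Complex.I) := Continuous.measurable (by fun_prop)
  exact (h1.sub hg.measurable).sub (hY.const_mul _)

lemma norm_le_of_quotientError_le (hg : Continuous g) {Y : ℂ → ℂ} {n : ℕ} {z : ℂ} {ε : ℝ}
    (hε : 0 ≤ ε) (hn : quotientError g Y n z ≤ ENNReal.ofReal ε) {h : ℝ}
    (hh : |h| < 1 / ((n : ℝ) + 1)) : ‖g (z + h * Complex.I) - g z - h * Y z‖ ≤ ε * |h| := by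
  set S : Set ℝ := {h | ‖g (z + h * Complex.I) - g z - h * Y z‖ ≤ ε * |h|} with hS
  have hclosed : IsClosed S := isClosed_le (by fun_prop) (by fun_prop)
  have hd : Dense (range ((↑) : ℚ → ℝ)) := Rat.denseRange_cast
  have hopen : IsOpen {h : ℝ | |h| < 1 / ((n : ℝ) + 1)} :=
    isOpen_lt continuous_abs continuous_const
  refine (closure_minimal ?_ hclosed) (hd.open_subset_closure_inter hopen hh)
  rintro _ ⟨hq, q, rfl⟩
  change ‖g (z + (q : ℝ) * Complex.I) - g z - (q : ℝ) * Y z‖ ≤ ε * |(q : ℝ)|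
  by_cases hq0 : (q : ℝ) = 0
  · rw [hq0]; simp
  rw [← div_le_iff₀ (abs_pos.2 hq0)]
  rw [← ENNReal.ofReal_le_ofReal_iff hε]
  exact (le_iSup₂ (f := fun (h : ℚ) (_ : |(h : ℝ)| < 1 / ((n : ℝ) + 1)) =>
    ENNReal.ofReal (‖g (z + (h : ℝ) * Complex.I) - g z - (h : ℝ) * Y z‖ / |(h : ℝ)|)) q hq).trans hn

lemma tendsto_quotientError {Y : ℂ → ℂ} {z : ℂ} (h : HasLineDerivAt ℝ g (Y z) z Complex.I) :
    Tendsto (fun n => quotientError g Y n z) atTop (𝓝 0) := by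
  rw [ENNReal.tendsto_nhds_zero]
  intro ε hε
  obtain ⟨δ, hδ, hδε⟩ := ENNReal.lt_iff_exists_nnreal_btwn.1 hε
  have hδ0 : (0 : ℝ) < δ := by exact_mod_cast hδ
  have h' := hasDerivAt_iff_isLittleO_nhds_zero.1 h
  rw [Asymptotics.isLittleO_iff] at h'
  obtain ⟨r, hr, hr'⟩ := Metric.eventually_nhds_iff.1 (h' hδ0)
  filter_upwards [(tendsto_order.1 tendsto_one_div_add_atTop_nhds_zero_nat).2 r hr] with n hn
  refine (iSup₂_le fun q hq => ?_).trans hδε.le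
  rw [← ENNReal.ofReal_coe_nnreal]
  refine ENNReal.ofReal_le_ofReal (div_le_of_le_mul₀ (abs_nonneg _) hδ0.le ?_)
  have := hr' (y := (q : ℝ)) (by rw [dist_zero_right, Real.norm_eq_abs]; linarith)
  rw [Real.norm_eq_abs] at this
  simpa using this

/-- Egorov's theorem for the difference quotients in the direction `I`. -/
lemma exists_uniformLineDeriv (hg : Continuous g) {Y : ℂ → ℂ} (hY : Measurable Y) {E : Set ℂ}
    (hE : MeasurableSet E) (hEfin : volume E ≠ ⊤)
    (hd : ∀ z ∈ E, HasLineDerivAt ℝ g (Y z) z Complex.I) {ε : ℝ} (hε : 0 < ε) :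
    ∃ t ⊆ E, MeasurableSet t ∧ volume t ≤ ENNReal.ofReal ε ∧ UniformLineDeriv g Y (E \ t) := by
  -- The errors may be infinite; cut off at `1` they are real-valued, and small values are unchanged.
  have hmeas : ∀ n, Measurable fun z => (min 1 (quotientError g Y n z)).toReal := fun n =>
    (measurable_const.min (measurable_quotientError hg hY n)).ennreal_toReal
  have htend : ∀ z ∈ E, Tendsto (fun n => (min 1 (quotientError g Y n z)).toReal) atTop (𝓝 0) := by
    intro z hz
    have h1 : Tendsto (fun n => min 1 (quotientError g Y n z)) atTop (𝓝 (min 1 0)) :=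
      tendsto_const_nhds.min (tendsto_quotientError (hd z hz))
    have h2 := (ENNReal.tendsto_toReal (by simp)).comp h1
    simpa [Function.comp_def] using h2
  obtain ⟨t, htE, htm, hte, hunif⟩ := tendstoUniformlyOn_of_ae_tendsto (μ := volume)
    (fun n => (hmeas n).stronglyMeasurable) (stronglyMeasurable_const (b := (0 : ℝ))) hE hEfin
    (ae_of_all _ htend) hε
  refine ⟨t, htE, htm, hte, fun η hη => ?_⟩
  obtain ⟨n, hn⟩ := (Metric.tendstoUniformlyOn_iff.1 hunif (min η 1) (by positivity)).exists
  refine ⟨1 / ((n : ℝ) + 1), by positivity, fun z hz h hh => ?_⟩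
  refine norm_le_of_quotientError_le hg hη.le ?_ hh
  have h1 := hn z hz
  rw [dist_comm, dist_zero_right, Real.norm_of_nonneg ENNReal.toReal_nonneg, lt_min_iff] at h1
  have hne : min 1 (quotientError g Y n z) ≠ ⊤ := ne_top_of_le_ne_top ENNReal.one_ne_top
    (min_le_left _ _)
  have h2 : min 1 (quotientError g Y n z) < 1 := by
    have := (ENNReal.lt_ofReal_iff_toReal_lt hne).2 h1.2
    simpa using this
  have h3 : min 1 (quotientError g Y n z) < ENNReal.ofReal η :=
    (ENNReal.lt_ofReal_iff_toReal_lt hne).2 h1.1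
  rcases min_choice 1 (quotientError g Y n z) with h4 | h4
  · rw [h4] at h2; exact absurd h2 (lt_irrefl _)
  · rw [h4] at h3; exact h3.le

/-- The area inequality for injective continuous maps with partial derivatives. It holds off
exceptional sets of measure at most `2⁻ⁿ`; by the Borel–Cantelli lemma almost every point is in only
finitely many of them, and Fatou's lemma applies. -/
theorem lintegral_jacobian_le_of_lineDeriv (hg : Continuous g) {E : Set ℂ} (hE : MeasurableSet E)
    (hEfin : volume E ≠ ⊤) (hinj : InjOn g E)
    (h1 : ∀ z ∈ E, LineDifferentiableAt ℝ g z 1)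
    (hI : ∀ z ∈ E, LineDifferentiableAt ℝ g z Complex.I) :
    ∫⁻ z in E, ENNReal.ofReal |(ofColumns (lineDeriv ℝ g z 1) (lineDeriv ℝ g z Complex.I)).det| ≤
      volume (g '' E) := by
  set D : ℂ → ENNReal := fun z =>
    ENNReal.ofReal |(ofColumns (lineDeriv ℝ g z 1) (lineDeriv ℝ g z Complex.I)).det| with hD
  have hYm : Measurable fun z => lineDeriv ℝ g z Complex.I := measurable_lineDeriv hg
  have hXm : Measurable fun z => lineDeriv ℝ g z 1 := measurable_lineDeriv hg
  have hDm : Measurable D := by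
    simp only [hD, det_ofColumns]
    refine ENNReal.measurable_ofReal.comp (Measurable.comp (g := fun x : ℝ => |x|)
      measurable_norm ?_)
    exact ((Complex.measurable_re.comp hXm).mul (Complex.measurable_im.comp hYm)).sub
      ((Complex.measurable_im.comp hXm).mul (Complex.measurable_re.comp hYm))
  have hex : ∀ n : ℕ, ∃ t ⊆ E, MeasurableSet t ∧ volume t ≤ ENNReal.ofReal ((1 / 2) ^ n) ∧
      UniformLineDeriv g (fun z => lineDeriv ℝ g z Complex.I) (E \ t) := fun n =>
    exists_uniformLineDeriv hg hYm hE hEfin (fun z hz => (hI z hz).hasLineDerivAt) (by positivity)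
  choose t htE htm ht hU using hex
  have hpiece : ∀ n, ∫⁻ z in E, (t n)ᶜ.indicator D z ≤ volume (g '' E) := fun n => by
    have hmE : MeasurableSet (E \ t n) := hE.diff (htm n)
    rw [lintegral_indicator (htm n).compl, Measure.restrict_restrict (htm n).compl,
      inter_comm, ← sdiff_eq]
    rw [lintegral_abs_det_fderiv_eq_addHaar_image volume hmE
      (fun z hz => (hU n).hasFDerivWithinAt hg hz (h1 z hz.1).hasLineDerivAt)
      (hinj.mono sdiff_subset)]
    exact measure_mono (image_mono sdiff_subset)
  have hsum : ∑' n, volume.restrict E (t n) ≠ ⊤ := by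
    refine ne_top_of_le_ne_top ?_ (ENNReal.tsum_le_tsum fun n =>
      (Measure.restrict_apply_le _ _).trans (ht n))
    rw [← ENNReal.ofReal_tsum_of_nonneg (fun n => by positivity) summable_geometric_two]
    exact ENNReal.ofReal_ne_top
  calc ∫⁻ z in E, D z = ∫⁻ z in E, liminf (fun n => (t n)ᶜ.indicator D z) atTop := by
        refine lintegral_congr_ae ?_
        filter_upwards [ae_eventually_notMem hsum] with z hz
        have : (fun n => (t n)ᶜ.indicator D z) =ᶠ[atTop] fun _ => D z := by
          filter_upwards [hz] with n hn
          exact indicator_of_mem hn _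
        rw [(tendsto_const_nhds.congr' this.symm).liminf_eq]
    _ ≤ liminf (fun n => ∫⁻ z in E, (t n)ᶜ.indicator D z) atTop :=
        lintegral_liminf_le fun n => hDm.indicator (htm n).compl
    _ ≤ volume (g '' E) := by
        refine liminf_le_of_frequently_le' (Frequently.of_forall hpiece)

end Area

/-! ### Sobolev functions on a rectangle -/

section Transfer

variable {A B : ℝ} {F H : ℝ × ℝ → ℂ}

/-- Absolute continuity up to the boundary, when the weak derivative is integrable. -/
lemma IsWeakPartialSnd.ae_eq_add_integral (hB : 0 < B) (hF : Continuous F)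
    (hH : IntegrableOn H (Ioo 0 A ×ˢ Ioo 0 B)) (hw : IsWeakPartialSnd A B F H) :
    ∀ᵐ s, s ∈ Ioo 0 A → ∀ b ∈ Icc 0 B, F (s, b) = F (s, 0) + ∫ t in (0 : ℝ)..b, H (s, t) := by
  have hi : ∀ᵐ s, s ∈ Ioo 0 A → IntegrableOn (fun t => H (s, t)) (Ioo 0 B) := by
    rw [IntegrableOn, Measure.volume_eq_prod, ← Measure.prod_restrict] at hH
    exact (ae_restrict_iff' measurableSet_Ioo).1 hH.prod_right_ae
  filter_upwards [hi, hw.ae_forall_sub_eq hF hH.locallyIntegrableOn] with s hi h hsA b hb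
  have hIcc : IntegrableOn (fun t => H (s, t)) (Icc 0 B) :=
    (integrableOn_Icc_iff_integrableOn_Ioo (by finiteness) (by finiteness)).2 (hi hsA)
  have hint : ∀ t ∈ Icc 0 B, IntervalIntegrable (fun t => H (s, t)) volume 0 t := fun t ht =>
    (intervalIntegrable_iff_integrableOn_Icc_of_le ht.1).2
      (hIcc.mono_set (Icc_subset_Icc_right ht.2))
  have hFs : Continuous fun t => F (s, t) := by fun_prop
  have hcont : ContinuousOn (fun t => F (s, t) - ∫ τ in (0 : ℝ)..t, H (s, τ)) (Icc 0 B) := by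
    refine hFs.continuousOn.sub ?_
    have := intervalIntegral.continuousOn_primitive_interval (μ := volume)
      (f := fun τ => H (s, τ)) (a := 0) (b := B) (by rwa [uIcc_of_le hB.le])
    rwa [uIcc_of_le hB.le] at this
  have hmid : B / 2 ∈ Ioo 0 B := ⟨by linarith, by linarith⟩
  have hkey : EqOn (fun t => F (s, t) - ∫ τ in (0 : ℝ)..t, H (s, τ))
      (fun _ => F (s, B / 2) - ∫ τ in (0 : ℝ)..(B / 2), H (s, τ)) (Icc 0 B) := by
    refine EqOn.of_subset_closure (s := Ioo 0 B) ?_ hcont continuousOn_const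
      Ioo_subset_Icc_self (by rw [closure_Ioo hB.ne])
    have hle : ∀ x ∈ Ioo 0 B, ∀ y ∈ Ioo 0 B, x ≤ y → F (s, x) - ∫ τ in (0 : ℝ)..x, H (s, τ) =
        F (s, y) - ∫ τ in (0 : ℝ)..y, H (s, τ) := by
      intro x hx y hy hxy
      have h1 := (h hsA x y hx.1 hxy hy.2).2
      rw [← intervalIntegral.integral_interval_sub_left (hint y (Ioo_subset_Icc_self hy))
        (hint x (Ioo_subset_Icc_self hx))] at h1
      linear_combination -h1
    intro t ht
    rcases le_total t (B / 2) with htB | htB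
    · exact hle t ht _ hmid htB
    · exact (hle _ hmid t ht htB).symm
  have e1 := hkey hb
  have e2 := hkey (left_mem_Icc.2 hB.le)
  simp only [intervalIntegral.integral_same, sub_zero] at e1 e2
  rw [← e2] at e1
  linear_combination e1

/-- The integral of a weak derivative in terms of the boundary values. -/
lemma IsWeakPartialSnd.setIntegral_smul (hB : 0 < B) (hF : Continuous F)
    (hH : IntegrableOn H (Ioo 0 A ×ˢ Ioo 0 B)) (hw : IsWeakPartialSnd A B F H)
    {k : ℝ → ℝ} (hkm : Measurable k) {C : ℝ} (hk : ∀ s, |k s| ≤ C) :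
    ∫ z in Ioo 0 A ×ˢ Ioo 0 B, k z.1 • H z = ∫ s in Ioo 0 A, k s • (F (s, B) - F (s, 0)) := by
  have hint : IntegrableOn (fun z : ℝ × ℝ => k z.1 • H z) (Ioo 0 A ×ˢ Ioo 0 B) :=
    Integrable.bdd_smul (φ := fun z : ℝ × ℝ => k z.1) hH C
      (hkm.comp measurable_fst).aestronglyMeasurable (ae_of_all _ fun z => hk z.1)
  rw [Measure.volume_eq_prod, setIntegral_prod _ (by rwa [← Measure.volume_eq_prod])]
  refine setIntegral_congr_ae measurableSet_Ioo ?_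
  filter_upwards [hw.ae_eq_add_integral hB hF hH] with s hs hsA
  rw [integral_smul, hs hsA B (right_mem_Icc.2 hB.le), intervalIntegral.integral_of_le hB.le,
    integral_Ioc_eq_integral_Ioo, add_sub_cancel_left]

variable {Ω : Set ℂ} {v : ℂ} {f f' g : ℂ → ℂ} {e : (ℝ × ℝ) ≃L[ℝ] ℂ}

lemma image_subset_of_preimage_eq (hpre : e ⁻¹' Ω = Ioo 0 A ×ˢ Ioo 0 B) {K : Set (ℝ × ℝ)}
    (hK : K ⊆ Ioo 0 A ×ˢ Ioo 0 B) : e '' K ⊆ Ω := by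
  rw [image_subset_iff, hpre]
  exact hK

lemma locallyIntegrableOn_comp_equiv (he : MeasurePreserving e)
    (hpre : e ⁻¹' Ω = Ioo 0 A ×ˢ Ioo 0 B) (hg : LocallyIntegrableOn g Ω) :
    LocallyIntegrableOn (g ∘ e) (Ioo 0 A ×ˢ Ioo 0 B) := by
  rw [locallyIntegrableOn_iff (isOpen_Ioo.prod isOpen_Ioo).isLocallyClosed]
  intro K hKs hK
  have := hg.integrableOn_compact_subset (image_subset_of_preimage_eq hpre hKs)
    (hK.image e.continuous)
  exact (he.integrableOn_image e.toHomeomorph.measurableEmbedding).1 this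

/-- In product coordinates, products of one-dimensional test functions are test functions on `Ω`. The
values of `f` outside `Ω` do not matter. -/
lemma IsWeakPartial.comp_equiv (he : MeasurePreserving e)
    (hpre : e ⁻¹' Ω = Ioo 0 A ×ˢ Ioo 0 B) (hv : e (0, 1) = v) (hff' : EqOn f' f Ω)
    (h : IsWeakPartial Ω v f g) : IsWeakPartialSnd A B (f' ∘ e) (g ∘ e) := by
  intro θ ψ hθ hθc hθA hψ hψc hψB
  set η : ℂ → ℝ := fun z => θ (e.symm z).1 * ψ (e.symm z).2 with hη
  have hηd : ContDiff ℝ ∞ η :=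
    (hθ.comp (contDiff_fst.comp e.symm.contDiff)).mul (hψ.comp (contDiff_snd.comp e.symm.contDiff))
  have hKc : IsCompact (e '' (tsupport θ ×ˢ tsupport ψ)) :=
    (hθc.isCompact.prod hψc.isCompact).image e.continuous
  have hsub : Function.support η ⊆ e '' (tsupport θ ×ˢ tsupport ψ) := by
    intro z hz
    refine ⟨e.symm z, ⟨subset_tsupport _ ?_, subset_tsupport _ ?_⟩, e.apply_symm_apply z⟩
    · exact fun h0 => hz (by simp [hη, h0])
    · exact fun h0 => hz (by simp [hη, h0])
  have hηc : HasCompactSupport η := HasCompactSupport.of_support_subset_isCompact hKc hsub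
  have hηΩ : tsupport η ⊆ Ω := (closure_minimal hsub hKc.isClosed).trans
    (image_subset_of_preimage_eq hpre (prod_mono hθA hψB))
  have key := h.2 η hηd hηc hηΩ
  have hfd : ∀ w, fderiv ℝ η (e w) v = θ w.1 * deriv ψ w.2 := by
    intro w
    rw [← (hηd.differentiable (by simp) (e w)).lineDeriv_eq_fderiv, ← hv]
    have : ∀ t : ℝ, η (e w + t • e (0, 1)) = θ w.1 * ψ (w.2 + t) := by
      intro t
      rw [← map_smul, ← map_add]
      simp [hη]
    rw [lineDeriv]
    simp only [this]
    rw [deriv_const_mul_field, deriv_comp_const_add, add_zero]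
  have hemb := e.toHomeomorph.measurableEmbedding
  have h1 : ∫ z, (fderiv ℝ η z v) • f z = ∫ z, (fderiv ℝ η z v) • f' z := by
    refine integral_congr_ae (ae_of_all _ fun z => ?_)
    by_cases hz : z ∈ Ω
    · simp only [hff' hz]
    · have : fderiv ℝ η z = 0 :=
        image_eq_zero_of_notMem_tsupport fun h => hz (hηΩ (tsupport_fderiv_subset ℝ h))
      simp [this]
  rw [h1, ← he.integral_comp hemb, ← he.integral_comp hemb] at key
  simp only [hfd] at key
  simpa [hη] using key

end Transfer

section Rectangle

variable {ℓ L : ℝ} {f : ℂ → ℂ}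

/-- The retraction of the plane onto the closed rectangle. -/
noncomputable def clampRect (ℓ : ℝ) (z : ℂ) : ℂ := ⟨max 0 (min ℓ z.re), max 0 (min 1 z.im)⟩

lemma continuous_clampRect : Continuous (clampRect ℓ) := by
  have h : clampRect ℓ = fun z => ((max 0 (min ℓ z.re) : ℝ) : ℂ) +
      ((max 0 (min 1 z.im) : ℝ) : ℂ) * Complex.I := by
    funext z; apply Complex.ext <;> simp [clampRect]
  rw [h]
  fun_prop

lemma mem_rect {z : ℂ} : z ∈ rect ℓ ↔ (0 ≤ z.re ∧ z.re ≤ ℓ) ∧ 0 ≤ z.im ∧ z.im ≤ 1 := Iff.rfl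

lemma openRect_subset_rect : openRect ℓ ⊆ rect ℓ := fun _ hz =>
  ⟨Ioo_subset_Icc_self hz.1, Ioo_subset_Icc_self hz.2⟩

lemma clampRect_mem (hℓ : 0 < ℓ) (z : ℂ) : clampRect ℓ z ∈ rect ℓ := by
  rw [mem_rect]
  simp [clampRect, hℓ.le]

lemma clampRect_eq {z : ℂ} (hz : z ∈ rect ℓ) : clampRect ℓ z = z := by
  rw [mem_rect] at hz
  apply Complex.ext <;> simp [clampRect, hz.1.1, hz.1.2, hz.2.1, hz.2.2]

/-- A continuous extension to the plane of a function on the closed rectangle. -/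
noncomputable def extendRect (ℓ : ℝ) (f : ℂ → ℂ) : ℂ → ℂ := f ∘ clampRect ℓ

lemma continuous_extendRect (hℓ : 0 < ℓ) (hf : ContinuousOn f (rect ℓ)) :
    Continuous (extendRect ℓ f) :=
  hf.comp_continuous continuous_clampRect (clampRect_mem hℓ)

lemma extendRect_eqOn : EqOn (extendRect ℓ f) f (rect ℓ) := fun z hz => by
  rw [extendRect, Function.comp_apply, clampRect_eq hz]

/-- The coordinates `(s, t) ↦ s + t * I`. -/
noncomputable def vertCoord : (ℝ × ℝ) ≃L[ℝ] ℂ := Complex.equivRealProdCLM.symm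

/-- The coordinates `(s, t) ↦ t + s * I`. -/
noncomputable def horizCoord : (ℝ × ℝ) ≃L[ℝ] ℂ :=
  (ContinuousLinearEquiv.prodComm ℝ ℝ ℝ).trans vertCoord

lemma measurePreserving_vertCoord : MeasurePreserving vertCoord :=
  Complex.volume_preserving_equiv_real_prod.symm

lemma measurePreserving_horizCoord : MeasurePreserving horizCoord :=
  measurePreserving_vertCoord.comp Measure.measurePreserving_swap

lemma vertCoord_preimage_openRect : vertCoord ⁻¹' openRect ℓ = Ioo 0 ℓ ×ˢ Ioo 0 1 := rfl

lemma horizCoord_preimage_openRect : horizCoord ⁻¹' openRect ℓ = Ioo 0 1 ×ˢ Ioo 0 ℓ := by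
  ext w; exact and_comm

lemma vertCoord_snd : vertCoord (0, 1) = Complex.I := rfl

lemma horizCoord_snd : horizCoord (0, 1) = 1 := rfl

lemma isOpen_openRect : IsOpen (openRect ℓ) := isOpen_Ioo.reProdIm isOpen_Ioo

lemma isWeakPartial_weakPartial {Ω : Set ℂ} {v : ℂ} (h : ∃ g, IsWeakPartial Ω v f g) :
    IsWeakPartial Ω v f (weakPartial Ω v f) := by
  rw [weakPartial, dif_pos h]
  exact h.choose_spec

lemma weakPartialSnd_vert {Y : ℂ → ℂ} (h : IsWeakPartial (openRect ℓ) Complex.I f Y) :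
    IsWeakPartialSnd ℓ 1 (extendRect ℓ f ∘ vertCoord) (Y ∘ vertCoord) :=
  h.comp_equiv measurePreserving_vertCoord vertCoord_preimage_openRect vertCoord_snd
    (extendRect_eqOn.mono openRect_subset_rect)

lemma weakPartialSnd_horiz {X : ℂ → ℂ} (h : IsWeakPartial (openRect ℓ) 1 f X) :
    IsWeakPartialSnd 1 ℓ (extendRect ℓ f ∘ horizCoord) (X ∘ horizCoord) :=
  h.comp_equiv measurePreserving_horizCoord horizCoord_preimage_openRect horizCoord_snd
    (extendRect_eqOn.mono openRect_subset_rect)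

/-- Weak partial derivatives of continuous functions on the rectangle are classical ones. -/
lemma ae_hasLineDerivAt_of_equiv {e : (ℝ × ℝ) ≃L[ℝ] ℂ} {Ω : Set ℂ} {v : ℂ} {G X : ℂ → ℂ} {A B : ℝ}
    (he : MeasurePreserving e) (hpre : e ⁻¹' Ω = Ioo 0 A ×ˢ Ioo 0 B) (hv : e (0, 1) = v)
    (hG : Continuous G) (hX : LocallyIntegrableOn X Ω)
    (hw : IsWeakPartialSnd A B (G ∘ e) (X ∘ e)) :
    ∀ᵐ z, z ∈ Ω → HasLineDerivAt ℝ G (X z) z v := by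
  have h1 := hw.ae_hasDerivAt (hG.comp e.continuous) (locallyIntegrableOn_comp_equiv he hpre hX)
  have hesymm : MeasurePreserving e.symm :=
    he.symm (e := e.toHomeomorph.toMeasurableEquiv)
  filter_upwards [hesymm.quasiMeasurePreserving.ae h1] with z hz hzΩ
  have hmem : e.symm z ∈ Ioo 0 A ×ˢ Ioo 0 B := by
    rw [← hpre, mem_preimage, e.apply_symm_apply]; exact hzΩ
  have h2 := hz hmem
  rw [HasLineDerivAt]
  have h3 : (fun t : ℝ => G (z + t • v)) =
      fun t => (G ∘ e) ((e.symm z).1, (e.symm z).2 + t) := by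
    funext t
    have : ((e.symm z).1, (e.symm z).2 + t) = e.symm z + t • ((0 : ℝ), (1 : ℝ)) := by
      ext <;> simp
    rw [Function.comp_apply, this, map_add, map_smul, e.apply_symm_apply, hv]
  rw [h3]
  have h4 : HasDerivAt (fun t : ℝ => (e.symm z).2 + t) 1 0 := (hasDerivAt_id' 0).const_add _
  have h5 : HasDerivAt (fun t => (G ∘ e) ((e.symm z).1, t)) ((X ∘ e) (e.symm z))
      ((e.symm z).2 + 0) := by rwa [add_zero]
  have h6 := h5.scomp (0 : ℝ) h4
  rw [one_smul, Function.comp_apply, e.apply_symm_apply] at h6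
  exact h6

lemma ae_hasLineDerivAt (hℓ : 0 < ℓ) (hf : ContinuousOn f (rect ℓ)) {X Y : ℂ → ℂ}
    (hX : IsWeakPartial (openRect ℓ) 1 f X) (hY : IsWeakPartial (openRect ℓ) Complex.I f Y) :
    ∀ᵐ z, z ∈ openRect ℓ → HasLineDerivAt ℝ (extendRect ℓ f) (X z) z 1 ∧
      HasLineDerivAt ℝ (extendRect ℓ f) (Y z) z Complex.I := by
  filter_upwards [ae_hasLineDerivAt_of_equiv measurePreserving_horizCoord
      horizCoord_preimage_openRect horizCoord_snd (continuous_extendRect hℓ hf) hX.1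
      (weakPartialSnd_horiz hX),
    ae_hasLineDerivAt_of_equiv measurePreserving_vertCoord
      vertCoord_preimage_openRect vertCoord_snd (continuous_extendRect hℓ hf) hY.1
      (weakPartialSnd_vert hY)] with z h1 h2 hz
  exact ⟨h1 hz, h2 hz⟩

lemma volume_rect : volume (rect L) = ENNReal.ofReal L := by
  rw [← measurePreserving_vertCoord.measure_preimage_emb
    vertCoord.toHomeomorph.measurableEmbedding]
  have : vertCoord ⁻¹' rect L = Icc 0 L ×ˢ Icc 0 1 := rfl
  rw [this, Measure.volume_eq_prod, Measure.prod_prod]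
  simp

lemma openRect_ae_eq_rect : openRect ℓ =ᵐ[volume] rect ℓ := by
  have h : (Ioo 0 ℓ ×ˢ Ioo (0 : ℝ) 1 : Set (ℝ × ℝ)) =ᵐ[volume] (Icc 0 ℓ ×ˢ Icc 0 1 : Set (ℝ × ℝ)) := by
    rw [Measure.volume_eq_prod]
    exact Measure.set_prod_ae_eq Ioo_ae_eq_Icc Ioo_ae_eq_Icc
  exact Complex.volume_preserving_equiv_real_prod.quasiMeasurePreserving.preimage_ae_eq h

/-- The area inequality for homeomorphisms of Sobolev class `W^{1,1}_loc`. -/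
theorem lintegral_jacobian_le (hℓ : 0 < ℓ) (hf : ContinuousOn f (rect ℓ))
    (hbij : BijOn f (rect ℓ) (rect L)) {X Y : ℂ → ℂ}
    (hX : IsWeakPartial (openRect ℓ) 1 f X) (hY : IsWeakPartial (openRect ℓ) Complex.I f Y) :
    ∫⁻ z in openRect ℓ, ENNReal.ofReal |(X z).re * (Y z).im - (X z).im * (Y z).re| ≤
      ENNReal.ofReal L := by
  set G := extendRect ℓ f with hG
  have hGc : Continuous G := continuous_extendRect hℓ hf
  have hae := ae_hasLineDerivAt hℓ hf hX hY
  set E : Set ℂ := openRect ℓ ∩ ({z | LineDifferentiableAt ℝ G z 1} ∩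
    {z | LineDifferentiableAt ℝ G z Complex.I}) with hE
  have hEm : MeasurableSet E := isOpen_openRect.measurableSet.inter
    ((measurableSet_lineDifferentiableAt hGc).inter (measurableSet_lineDifferentiableAt hGc))
  have hER : E =ᵐ[volume] openRect ℓ := by
    filter_upwards [hae] with z hz
    refine propext ⟨fun h => h.1, fun h => ⟨h, (hz h).1.lineDifferentiableAt,
      (hz h).2.lineDifferentiableAt⟩⟩
  have hErect : E ⊆ rect ℓ := inter_subset_left.trans openRect_subset_rect
  have hEfin : volume E ≠ ⊤ := ne_top_of_le_ne_top
    (by rw [volume_rect]; exact ENNReal.ofReal_ne_top) (measure_mono hErect)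
  have hinj : InjOn G E := (hbij.injOn.congr extendRect_eqOn.symm).mono hErect
  have himg : G '' E ⊆ rect L := by
    rintro _ ⟨z, hz, rfl⟩
    rw [hG, extendRect_eqOn (hErect hz)]
    exact hbij.mapsTo (hErect hz)
  calc _ = ∫⁻ z in E, ENNReal.ofReal
          |(ofColumns (lineDeriv ℝ G z 1) (lineDeriv ℝ G z Complex.I)).det| := by
        rw [setLIntegral_congr hER]
        refine setLIntegral_congr_fun_ae isOpen_openRect.measurableSet ?_
        filter_upwards [hae] with z hz hzR
        rw [(hz hzR).1.lineDeriv, (hz hzR).2.lineDeriv, det_ofColumns]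
    _ ≤ volume (G '' E) := lintegral_jacobian_le_of_lineDeriv hGc hEm hEfin hinj
        (fun z hz => hz.2.1) (fun z hz => hz.2.2)
    _ ≤ ENNReal.ofReal L := (measure_mono himg).trans volume_rect.le

end Rectangle

/-! ### Maps that stretch the first coordinate -/

section Stretch

lemma IsWeakPartial.ae_eq {Ω : Set ℂ} (hΩ : IsOpen Ω) {v : ℂ} {f g₁ g₂ : ℂ → ℂ}
    (h₁ : IsWeakPartial Ω v f g₁) (h₂ : IsWeakPartial Ω v f g₂) :
    ∀ᵐ z, z ∈ Ω → g₁ z = g₂ z := by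
  have key := hΩ.ae_eq_zero_of_integral_contDiff_smul_eq_zero (h₁.1.sub h₂.1)
    fun η hη hηc hηΩ => ?_
  · filter_upwards [key] with z hz hzΩ
    exact sub_eq_zero.1 (hz hzΩ)
  · simp only [Pi.sub_apply, smul_sub]
    rw [integral_sub (integrable_smul_of_tsupport_subset h₁.1 hη.continuous hηc hηΩ)
      (integrable_smul_of_tsupport_subset h₂.1 hη.continuous hηc hηΩ)]
    have e1 := h₁.2 η hη hηc hηΩ
    have e2 := h₂.2 η hη hηc hηΩ
    rw [e1] at e2
    linear_combination -e2

/-- Integration by parts for Lipschitz functions, whose line derivatives exist almost everywhere. -/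
lemma integral_fderiv_mul_of_lipschitz {h H : ℂ → ℝ} {C : NNReal} (hh : LipschitzWith C h) {v : ℂ}
    (hH : ∀ᵐ z, lineDeriv ℝ h z v = H z) {η : ℂ → ℝ} (hη : ContDiff ℝ ∞ η)
    (hηc : HasCompactSupport η) :
    ∫ z, fderiv ℝ η z v * h z = - ∫ z, η z * H z := by
  obtain ⟨D, hD⟩ := ContDiff.lipschitzWith_of_hasCompactSupport hηc hη (by simp)
  have key := hh.integral_lineDeriv_mul_eq (μ := volume) hD hηc v
  have e1 : ∫ z, lineDeriv ℝ h z v * η z = ∫ z, η z * H z := by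
    refine integral_congr_ae ?_
    filter_upwards [hH] with z hz
    rw [hz, mul_comm]
  have e2 : ∫ z, lineDeriv ℝ η z (-v) * h z = - ∫ z, fderiv ℝ η z v * h z := by
    rw [← integral_neg]
    refine integral_congr_ae (ae_of_all _ fun z => ?_)
    simp only
    rw [(hη.differentiable (by simp) z).lineDeriv_eq_fderiv, map_neg, neg_mul]
  rw [e1, e2] at key
  rw [key, neg_neg]

lemma integral_ofReal_add_mul_I {F₁ F₂ : ℂ → ℝ} (h₁ : Integrable F₁) (h₂ : Integrable F₂) :
    ∫ z, ((F₁ z : ℂ) + (F₂ z : ℂ) * Complex.I) =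
      ((∫ z, F₁ z : ℝ) : ℂ) + ((∫ z, F₂ z : ℝ) : ℂ) * Complex.I := by
  rw [integral_add h₁.ofReal (h₂.ofReal.mul_const _), integral_mul_const,
    integral_complex_ofReal, integral_complex_ofReal]

/-- The weak derivative of a map with Lipschitz real and imaginary parts. -/
lemma isWeakPartial_of_lipschitz {Ω : Set ℂ} {v : ℂ} {h₁ h₂ H₁ H₂ : ℂ → ℝ} {C₁ C₂ : NNReal}
    (hh₁ : LipschitzWith C₁ h₁) (hh₂ : LipschitzWith C₂ h₂)
    (hl₁ : LocallyIntegrable H₁) (hl₂ : LocallyIntegrable H₂)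
    (hH₁ : ∀ᵐ z, lineDeriv ℝ h₁ z v = H₁ z) (hH₂ : ∀ᵐ z, lineDeriv ℝ h₂ z v = H₂ z) :
    IsWeakPartial Ω v (fun z => (h₁ z : ℂ) + (h₂ z : ℂ) * Complex.I)
      (fun z => (H₁ z : ℂ) + (H₂ z : ℂ) * Complex.I) := by
  refine ⟨?_, fun η hη hηc _ => ?_⟩
  · refine LocallyIntegrable.locallyIntegrableOn (fun z => ?_) _
    obtain ⟨U₁, hU₁, hi₁⟩ := hl₁ z
    obtain ⟨U₂, hU₂, hi₂⟩ := hl₂ z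
    refine ⟨U₁ ∩ U₂, inter_mem hU₁ hU₂, ?_⟩
    exact (hi₁.mono_set inter_subset_left).ofReal.add
      ((hi₂.mono_set inter_subset_right).ofReal.mul_const _)
  · have hfc : Continuous fun z => fderiv ℝ η z v :=
      (hη.continuous_fderiv (by simp)).clm_apply continuous_const
    have hfs : HasCompactSupport fun z => fderiv ℝ η z v := hηc.fderiv_apply (𝕜 := ℝ) v
    have i₁ : Integrable fun z => fderiv ℝ η z v * h₁ z :=
      (hfc.mul hh₁.continuous).integrable_of_hasCompactSupport hfs.mul_right
    have i₂ : Integrable fun z => fderiv ℝ η z v * h₂ z :=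
      (hfc.mul hh₂.continuous).integrable_of_hasCompactSupport hfs.mul_right
    have j₁ : Integrable fun z => η z * H₁ z :=
      hl₁.integrable_smul_left_of_hasCompactSupport hη.continuous hηc
    have j₂ : Integrable fun z => η z * H₂ z :=
      hl₂.integrable_smul_left_of_hasCompactSupport hη.continuous hηc
    have e1 := integral_ofReal_add_mul_I i₁ i₂
    have e2 := integral_ofReal_add_mul_I j₁ j₂
    rw [integral_fderiv_mul_of_lipschitz hh₁ hH₁ hη hηc,
      integral_fderiv_mul_of_lipschitz hh₂ hH₂ hη hηc] at e1
    simp only [Complex.real_smul]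
    calc _ = ∫ z, (((fderiv ℝ η z v * h₁ z : ℝ) : ℂ) +
          ((fderiv ℝ η z v * h₂ z : ℝ) : ℂ) * Complex.I) := by
          refine integral_congr_ae (ae_of_all _ fun z => ?_)
          push_cast; ring
      _ = - ∫ z, (((η z * H₁ z : ℝ) : ℂ) + ((η z * H₂ z : ℝ) : ℂ) * Complex.I) := by
          rw [e1, e2]; push_cast; ring
      _ = _ := by
          congr 1
          refine integral_congr_ae (ae_of_all _ fun z => ?_)
          push_cast; ring

lemma quasiMeasurePreserving_re :
    Measure.QuasiMeasurePreserving Complex.re (volume : Measure ℂ) volume :=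
  Measure.quasiMeasurePreserving_fst.comp
    Complex.volume_preserving_equiv_real_prod.quasiMeasurePreserving

/-- The map `x + i y ↦ ∫₀ˣ p + i y`. -/
noncomputable def stretch (p : ℝ → ℝ) (z : ℂ) : ℂ :=
  ((∫ t in (0 : ℝ)..z.re, p t : ℝ) : ℂ) + (z.im : ℂ) * Complex.I

variable {p : ℝ → ℝ} {a b ℓ L : ℝ}

lemma locallyIntegrable_of_bounds (hp : Measurable p) (ha : 0 < a) (hap : ∀ x, a ≤ p x)
    (hpb : ∀ x, p x ≤ b) : LocallyIntegrable p :=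
  (locallyIntegrable_const b).mono hp.aestronglyMeasurable (ae_of_all _ fun x => by
    rw [Real.norm_of_nonneg (ha.le.trans (hap x)),
      Real.norm_of_nonneg (ha.le.trans ((hap x).trans (hpb x)))]
    exact hpb x)

lemma intervalIntegrable_of_bounds (hp : Measurable p) (ha : 0 < a) (hap : ∀ x, a ≤ p x)
    (hpb : ∀ x, p x ≤ b) (x y : ℝ) : IntervalIntegrable p volume x y :=
  ((locallyIntegrable_of_bounds hp ha hap hpb).integrableOn_isCompact
    isCompact_uIcc).intervalIntegrable

lemma lipschitzWith_primitive (hp : Measurable p) (ha : 0 < a) (hap : ∀ x, a ≤ p x)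
    (hpb : ∀ x, p x ≤ b) : LipschitzWith b.toNNReal fun x => ∫ t in (0 : ℝ)..x, p t := by
  refine LipschitzWith.of_dist_le_mul fun x y => ?_
  have hi := intervalIntegrable_of_bounds hp ha hap hpb
  rw [dist_eq_norm, dist_eq_norm, intervalIntegral.integral_interval_sub_left (hi 0 x) (hi 0 y),
    Real.coe_toNNReal _ (ha.le.trans ((hap 0).trans (hpb 0))), Real.norm_eq_abs (x - y)]
  refine intervalIntegral.norm_integral_le_of_norm_le_const fun t _ => ?_
  rw [Real.norm_of_nonneg (ha.le.trans (hap t))]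
  exact hpb t

lemma strictMono_primitive (hp : Measurable p) (ha : 0 < a) (hap : ∀ x, a ≤ p x)
    (hpb : ∀ x, p x ≤ b) : StrictMono fun x => ∫ t in (0 : ℝ)..x, p t := by
  intro x y hxy
  have hi := intervalIntegrable_of_bounds hp ha hap hpb
  have h1 : ∫ _t in x..y, a ≤ ∫ t in x..y, p t :=
    intervalIntegral.integral_mono_on hxy.le intervalIntegrable_const (hi x y) fun t _ => hap t
  rw [intervalIntegral.integral_const, smul_eq_mul,
    ← intervalIntegral.integral_interval_sub_left (hi 0 y) (hi 0 x)] at h1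
  have : 0 < (y - x) * a := mul_pos (sub_pos.2 hxy) ha
  simp only
  linarith

lemma ae_lineDeriv_primitive_re (hp : LocallyIntegrable p) (c : ℂ) :
    ∀ᵐ z : ℂ, lineDeriv ℝ (fun z : ℂ => ∫ t in (0 : ℝ)..z.re, p t) z c = c.re * p z.re := by
  filter_upwards [quasiMeasurePreserving_re.ae
    (LocallyIntegrable.ae_hasDerivAt_integral hp)] with z hz
  have h1 : HasDerivAt (fun t : ℝ => z.re + t * c.re) c.re 0 := by
    simpa using ((hasDerivAt_id (0 : ℝ)).mul_const c.re).const_add z.re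
  have h2 : HasDerivAt (fun x => ∫ t in (0 : ℝ)..x, p t) (p z.re) (z.re + 0 * c.re) := by
    rw [zero_mul, add_zero]; exact hz 0
  have h3 := h2.comp 0 h1
  rw [lineDeriv, mul_comm, ← h3.deriv]
  congr 1
  funext t
  simp

lemma lineDeriv_im (z c : ℂ) : lineDeriv ℝ (fun z : ℂ => z.im) z c = c.im :=
  (Complex.imCLM.hasFDerivAt.hasLineDerivAt c).lineDeriv

lemma isWeakPartial_stretch (hp : Measurable p) (ha : 0 < a) (hap : ∀ x, a ≤ p x)
    (hpb : ∀ x, p x ≤ b) (Ω : Set ℂ) (c : ℂ) :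
    IsWeakPartial Ω c (stretch p) (fun z => ((c.re * p z.re : ℝ) : ℂ) + (c.im : ℂ) * Complex.I) := by
  have hloc : LocallyIntegrable fun z : ℂ => c.re * p z.re := by
    refine (locallyIntegrable_const (c.re * b)).mono
      ((hp.comp Complex.measurable_re).const_mul _).aestronglyMeasurable (ae_of_all _ fun z => ?_)
    rw [norm_mul, norm_mul, Real.norm_of_nonneg (ha.le.trans (hap _)),
      Real.norm_of_nonneg (ha.le.trans ((hap 0).trans (hpb 0)))]
    gcongr
    exact hpb _
  have hre : LipschitzWith 1 Complex.re :=
    LipschitzWith.of_dist_le_mul fun x y => by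
      simpa [dist_eq_norm] using Complex.abs_re_le_norm (x - y)
  have him : LipschitzWith 1 Complex.im :=
    LipschitzWith.of_dist_le_mul fun x y => by
      simpa [dist_eq_norm] using Complex.abs_im_le_norm (x - y)
  exact isWeakPartial_of_lipschitz ((lipschitzWith_primitive hp ha hap hpb).comp hre)
    him hloc (locallyIntegrable_const _)
    (ae_lineDeriv_primitive_re (locallyIntegrable_of_bounds hp ha hap hpb) c)
    (ae_of_all _ fun z => lineDeriv_im z c)

lemma isWeakPartial_stretch_one (hp : Measurable p) (ha : 0 < a) (hap : ∀ x, a ≤ p x)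
    (hpb : ∀ x, p x ≤ b) (Ω : Set ℂ) :
    IsWeakPartial Ω 1 (stretch p) (fun z => (p z.re : ℂ)) := by
  simpa using isWeakPartial_stretch hp ha hap hpb Ω 1

lemma isWeakPartial_stretch_I (hp : Measurable p) (ha : 0 < a) (hap : ∀ x, a ≤ p x)
    (hpb : ∀ x, p x ≤ b) (Ω : Set ℂ) :
    IsWeakPartial Ω Complex.I (stretch p) (fun _ => Complex.I) := by
  simpa using isWeakPartial_stretch hp ha hap hpb Ω Complex.I

/-- The weak partial derivatives of `stretch p`. -/
lemma ae_weakPartial_stretch (hp : Measurable p) (ha : 0 < a) (hap : ∀ x, a ≤ p x)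
    (hpb : ∀ x, p x ≤ b) : ∀ᵐ z ∂volume.restrict (openRect ℓ),
      weakPartial (openRect ℓ) 1 (stretch p) z = (p z.re : ℂ) ∧
      weakPartial (openRect ℓ) Complex.I (stretch p) z = Complex.I := by
  have h1 := isWeakPartial_stretch_one hp ha hap hpb (openRect ℓ)
  have hI := isWeakPartial_stretch_I hp ha hap hpb (openRect ℓ)
  rw [ae_restrict_iff' isOpen_openRect.measurableSet]
  filter_upwards [(isWeakPartial_weakPartial ⟨_, h1⟩).ae_eq isOpen_openRect h1,
    (isWeakPartial_weakPartial ⟨_, hI⟩).ae_eq isOpen_openRect hI] with z hz1 hz2 hz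
  exact ⟨hz1 hz, hz2 hz⟩

lemma stretch_re (z : ℂ) : (stretch p z).re = ∫ t in (0 : ℝ)..z.re, p t := by simp [stretch]

lemma stretch_im (z : ℂ) : (stretch p z).im = z.im := by simp [stretch]

lemma admissible_stretch (hℓ : 0 < ℓ) (hp : Measurable p) (ha : 0 < a) (hap : ∀ x, a ≤ p x)
    (hpb : ∀ x, p x ≤ b) (hL : ∫ x in (0 : ℝ)..ℓ, p x = L) : Admissible ℓ L (stretch p) := by
  have hmono := strictMono_primitive hp ha hap hpb
  have hucont : Continuous fun x => ∫ t in (0 : ℝ)..x, p t :=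
    (lipschitzWith_primitive hp ha hap hpb).continuous
  have h0 : ∫ t in (0 : ℝ)..0, p t = 0 := intervalIntegral.integral_same
  have hcont : Continuous (stretch p) :=
    (Complex.continuous_ofReal.comp (hucont.comp Complex.continuous_re)).add
      ((Complex.continuous_ofReal.comp Complex.continuous_im).mul continuous_const)
  refine ⟨hcont.continuousOn, ⟨?_, ?_, ?_⟩, ⟨⟨?_, ?_, ?_⟩, ?_, ?_⟩, ?_, ?_, ?_, ?_⟩
  · intro z hz
    rw [mem_rect] at hz ⊢
    rw [stretch_re, stretch_im, ← hL]
    refine ⟨⟨?_, hmono.monotone hz.1.2⟩, hz.2⟩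
    exact h0.symm.le.trans (hmono.monotone hz.1.1)
  · intro z _ z' _ h
    have hre := congrArg Complex.re h
    have him := congrArg Complex.im h
    rw [stretch_re, stretch_re] at hre
    rw [stretch_im, stretch_im] at him
    exact Complex.ext (hmono.injective hre) him
  · intro w hw
    rw [mem_rect] at hw
    obtain ⟨x, hx, hxw⟩ := intermediate_value_Icc hℓ.le hucont.continuousOn
      (show w.re ∈ Icc _ _ by simp only [h0, hL]; exact hw.1)
    refine ⟨⟨x, w.im⟩, ⟨hx, hw.2⟩, Complex.ext ?_ ?_⟩
    · rw [stretch_re]; exact hxw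
    · rw [stretch_im]
  · exact (hcont.locallyIntegrable).locallyIntegrableOn _
  · exact ⟨_, isWeakPartial_stretch_one hp ha hap hpb _⟩
  · exact ⟨_, isWeakPartial_stretch_I hp ha hap hpb _⟩
  · filter_upwards [ae_weakPartial_stretch hp ha hap hpb] with z hz
    rw [jacobian, hz.1, hz.2]
    simpa using ha.le.trans (hap _)
  · refine ⟨fun z => p z.re + (p z.re)⁻¹, ?_⟩
    filter_upwards [ae_weakPartial_stretch hp ha hap hpb] with z hz
    have hpos : 0 < p z.re := ha.trans_le (hap _)
    rw [jacobian, normDSq, hz.1, hz.2]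
    simp only [Complex.norm_real, Complex.norm_I, Real.norm_eq_abs, sq_abs]
    simp
    field_simp
    exact le_rfl
  · intro z _ hz
    rw [stretch_re, hz, h0]
  · intro z _ hz
    rw [stretch_re, hz, hL]
  · intro z _ hz
    rw [stretch_im, hz]
  · intro z _ hz
    rw [stretch_im, hz]

lemma ae_distortion_stretch (hp : Measurable p) (ha : 0 < a) (hap : ∀ x, a ≤ p x)
    (hpb : ∀ x, p x ≤ b) : ∀ᵐ z ∂volume.restrict (openRect ℓ),
      distortion (openRect ℓ) (stretch p) z = p z.re + (p z.re)⁻¹ := by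
  filter_upwards [ae_weakPartial_stretch hp ha hap hpb] with z hz
  have hpos : 0 < p z.re := ha.trans_le (hap _)
  rw [distortion, jacobian, normDSq, hz.1, hz.2]
  simp only [Complex.norm_real, Complex.norm_I, Real.norm_eq_abs, sq_abs]
  simp [hpos]
  field_simp

end Stretch

/-! ### The energy density and integrals of null Lagrangians -/

section Energy

lemma distortion_eq (Ω : Set ℂ) (g : ℂ → ℂ) (z : ℂ) : distortion Ω g z =
    matDistortion (weakPartial Ω 1 g z).re (weakPartial Ω 1 g z).im
      (weakPartial Ω Complex.I g z).re (weakPartial Ω Complex.I g z).im := by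
  simp only [distortion, matDistortion, normDSq, jacobian, Complex.sq_norm, Complex.normSq_apply,
    ← pow_two]

lemma normDSq_eq (Ω : Set ℂ) (g : ℂ → ℂ) (z : ℂ) : normDSq Ω g z =
    (weakPartial Ω 1 g z).re ^ 2 + (weakPartial Ω 1 g z).im ^ 2 +
      ((weakPartial Ω Complex.I g z).re ^ 2 + (weakPartial Ω Complex.I g z).im ^ 2) := by
  simp only [normDSq, Complex.sq_norm, Complex.normSq_apply, ← pow_two]

lemma measurable_matDistortion :
    Measurable fun q : ℂ × ℂ => matDistortion q.1.re q.1.im q.2.re q.2.im := by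
  unfold matDistortion
  refine Measurable.ite (measurableSet_lt measurable_const ?_) ?_ measurable_const
  · exact Continuous.measurable (by fun_prop)
  · refine Measurable.div ?_ ?_ <;> exact Continuous.measurable (by fun_prop)

variable {φ : ℝ → ℝ}

/-- The convexity of the integrand at the minimiser, combined with the pointwise inequalities for
the distortion. By the Euler–Lagrange equation the factor in front of the null Lagrangians is the
constant `|α|`, so the integral of the left-hand side is controlled by the boundary values and the
area. If `α = 0` equality determines the distortion only. -/
lemma density_lower (hs : ContDiffOn ℝ ∞ φ (Ici 1)) (hc : ConvexOn ℝ (Ici 1) φ)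
    (hi : StrictMonoOn φ (Ici 1)) {W α q a b c d k : ℝ} (hW : 0 < W) (hq : 0 < q)
    (hα : W * profileDeriv φ q = α) (h0 : 0 ≤ a * d - b * c)
    (hk : a ^ 2 + b ^ 2 + (c ^ 2 + d ^ 2) ≤ k * (a * d - b * c)) :
    |α| * ((if 0 < α then 2 * a else 2 * q * d) - (a * d - b * c) - q) ≤
      φ (matDistortion a b c d) * W - φ (q + q⁻¹) * W ∧
    (|α| * ((if 0 < α then 2 * a else 2 * q * d) - (a * d - b * c) - q) =
      φ (matDistortion a b c d) * W - φ (q + q⁻¹) * W →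
      (α = 0 → q = 1 ∧ matDistortion a b c d = 2) ∧
      (α ≠ 0 → a = q ∧ b = 0 ∧ c = 0 ∧ d = 1)) := by
  set K := matDistortion a b c d with hK
  have hK2 : 2 ≤ K := two_le_matDistortion a b c d
  have ht2 := two_le_add_inv hq
  set t₀ := q + q⁻¹ with ht₀
  have hc0 : 0 < deriv φ t₀ := deriv_pos_of_strictMonoOn hs hc hi (by linarith)
  have htan := tangent_le hs hc (t := t₀) (s := K) (by linarith) (by linarith)
  have hWc : 0 < W * deriv φ t₀ := mul_pos hW hc0
  have hstep : W * deriv φ t₀ * (K - t₀) ≤ φ K * W - φ t₀ * W := by nlinarith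
  have hα' : W * deriv φ t₀ * (1 - (q ^ 2)⁻¹) = α := by
    rw [← hα, profileDeriv]; ring
  rcases lt_trichotomy α 0 with h | h | h
  · have hq1 : q < 1 := by
      by_contra hcon
      have : (q ^ 2)⁻¹ ≤ 1 := inv_le_one_of_one_le₀ (by nlinarith)
      have := mul_nonneg hWc.le (sub_nonneg.2 this)
      linarith
    obtain ⟨hle, heq⟩ := matDistortion_lower_of_lt_one hq hq1 h0 hk
    rw [if_neg (not_lt.2 h.le), abs_of_neg h, ← hα']
    have e : -(W * deriv φ t₀ * (1 - (q ^ 2)⁻¹)) * (2 * q * d - (a * d - b * c) - q) =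
        W * deriv φ t₀ * (((q ^ 2)⁻¹ - 1) * (2 * q * d - (a * d - b * c) - q)) := by ring
    rw [e]
    have hmul := mul_le_mul_of_nonneg_left hle hWc.le
    refine ⟨hmul.trans hstep, fun h' => ⟨fun h'' => absurd h'' (by rw [hα']; exact h.ne),
      fun _ => heq ?_⟩⟩
    exact mul_left_cancel₀ hWc.ne' (le_antisymm hmul (hstep.trans h'.symm.le))
  · have hq1 : q = 1 := by
      rw [h] at hα'
      have h1 := (mul_eq_zero.1 hα').resolve_left hWc.ne'
      have h2 : (q ^ 2)⁻¹ = 1 := by linarith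
      have h3 : q ^ 2 = 1 := inv_eq_one.1 h2
      exact (pow_eq_one_iff_of_nonneg hq.le two_ne_zero).1 h3
    have ht : t₀ = 2 := by rw [ht₀, hq1]; norm_num
    rw [h, abs_zero, zero_mul]
    have hnn : 0 ≤ W * deriv φ t₀ * (K - t₀) := mul_nonneg hWc.le (by linarith)
    refine ⟨hnn.trans hstep, fun h' => ⟨fun _ => ⟨hq1, ?_⟩, fun h'' => absurd rfl h''⟩⟩
    have h1 : W * deriv φ t₀ * (K - t₀) = 0 := le_antisymm (hstep.trans h'.symm.le) hnn
    have h2 := (mul_eq_zero.1 h1).resolve_left hWc.ne'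
    linarith
  · have hq1 : 1 < q := by
      by_contra hcon
      have : 1 ≤ (q ^ 2)⁻¹ := one_le_inv_iff₀.2 ⟨by positivity, by nlinarith⟩
      have := mul_nonneg hWc.le (sub_nonneg.2 this)
      linarith
    obtain ⟨hle, heq⟩ := matDistortion_lower_of_one_lt hq1 h0 hk
    rw [if_pos h, abs_of_pos h, ← hα']
    have e : W * deriv φ t₀ * (1 - (q ^ 2)⁻¹) * (2 * a - (a * d - b * c) - q) =
        W * deriv φ t₀ * ((1 - (q ^ 2)⁻¹) * (2 * a - (a * d - b * c) - q)) := by ring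
    rw [e]
    have hmul := mul_le_mul_of_nonneg_left hle hWc.le
    refine ⟨hmul.trans hstep, fun h' => ⟨fun h'' => absurd h'' (by rw [hα']; exact h.ne'),
      fun _ => heq ?_⟩⟩
    exact mul_left_cancel₀ hWc.ne' (le_antisymm hmul (hstep.trans h'.symm.le))

variable {ℓ L : ℝ} {g : ℂ → ℂ}

instance isFiniteMeasure_restrict_openRect :
    IsFiniteMeasure (volume.restrict (openRect ℓ)) := by
  refine ⟨?_⟩
  rw [Measure.restrict_apply_univ]
  exact (measure_mono openRect_subset_rect).trans_lt
    (by rw [volume_rect]; exact ENNReal.ofReal_lt_top)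

lemma integrableOn_comp_vertCoord {X : ℂ → ℂ} (hX : IntegrableOn X (openRect ℓ)) :
    IntegrableOn (X ∘ vertCoord) (Ioo 0 ℓ ×ˢ Ioo 0 1) :=
  (measurePreserving_vertCoord.integrableOn_comp_preimage
    vertCoord.toHomeomorph.measurableEmbedding).2 hX

lemma integrableOn_comp_horizCoord {X : ℂ → ℂ} (hX : IntegrableOn X (openRect ℓ)) :
    IntegrableOn (X ∘ horizCoord) (Ioo 0 1 ×ˢ Ioo 0 ℓ) := by
  rw [← horizCoord_preimage_openRect]
  exact (measurePreserving_horizCoord.integrableOn_comp_preimage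
    horizCoord.toHomeomorph.measurableEmbedding).2 hX

/-- The boundary values on the vertical sides determine the integral of `Re f_x`. -/
lemma integral_re_eq (hℓ : 0 < ℓ) (hg : Admissible ℓ L g) {X : ℂ → ℂ}
    (hX : IsWeakPartial (openRect ℓ) 1 g X) (hXi : IntegrableOn X (openRect ℓ)) :
    ∫ z in openRect ℓ, (X z).re = L := by
  have hG := continuous_extendRect hℓ hg.continuousOn
  have hflux := (weakPartialSnd_horiz hX).setIntegral_smul hℓ (hG.comp horizCoord.continuous)
    (integrableOn_comp_horizCoord hXi) (k := fun _ => 1) measurable_const (C := 1) (by simp)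
  have h1 : ∫ z in openRect ℓ, (X z).re = Complex.re (∫ z in openRect ℓ, X z) :=
    Complex.reCLM.integral_comp_comm hXi
  rw [h1, ← measurePreserving_horizCoord.setIntegral_preimage_emb
    horizCoord.toHomeomorph.measurableEmbedding, horizCoord_preimage_openRect]
  simp only [one_smul, Function.comp_apply] at hflux
  rw [hflux]
  have hi : IntegrableOn (fun s : ℝ => extendRect ℓ g (horizCoord (s, ℓ)) -
      extendRect ℓ g (horizCoord (s, 0))) (Ioo 0 1) := by
    refine (Continuous.integrableOn_Icc (a := 0) (b := 1) ?_).mono_set Ioo_subset_Icc_self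
    have := horizCoord.continuous
    fun_prop
  have h2 := Complex.reCLM.integral_comp_comm hi
  simp only [Complex.reCLM_apply] at h2
  rw [← h2, setIntegral_congr_fun (g := fun _ => L) measurableSet_Ioo]
  · simp
  · intro s hs
    have m1 : horizCoord (s, ℓ) ∈ rect ℓ := ⟨⟨hℓ.le, le_rfl⟩, Ioo_subset_Icc_self hs⟩
    have m0 : horizCoord (s, 0) ∈ rect ℓ := ⟨⟨le_rfl, hℓ.le⟩, Ioo_subset_Icc_self hs⟩
    simp only [Complex.sub_re]
    rw [extendRect_eqOn m1, extendRect_eqOn m0, hg.right _ m1 rfl, hg.left _ m0 rfl, sub_zero]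

/-- The boundary values on the horizontal sides determine the weighted integrals of `Im f_y`. -/
lemma integral_mul_im_eq (hℓ : 0 < ℓ) (hg : Admissible ℓ L g) {Y : ℂ → ℂ}
    (hY : IsWeakPartial (openRect ℓ) Complex.I g Y) (hYi : IntegrableOn Y (openRect ℓ))
    {k : ℝ → ℝ} (hkm : Measurable k) {C : ℝ} (hk : ∀ s, |k s| ≤ C) :
    ∫ z in openRect ℓ, k z.re * (Y z).im = ∫ x in (0 : ℝ)..ℓ, k x := by
  have hG := continuous_extendRect hℓ hg.continuousOn
  have hflux := (weakPartialSnd_vert hY).setIntegral_smul one_pos (hG.comp vertCoord.continuous)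
    (integrableOn_comp_vertCoord hYi) hkm hk
  have hkYi : IntegrableOn (fun z => k z.re • Y z) (openRect ℓ) :=
    Integrable.bdd_smul (φ := fun z : ℂ => k z.re) hYi C
      (hkm.comp Complex.measurable_re).aestronglyMeasurable (ae_of_all _ fun z => hk z.re)
  have h1 : ∫ z in openRect ℓ, k z.re * (Y z).im = Complex.im (∫ z in openRect ℓ, k z.re • Y z) := by
    rw [← Complex.imCLM_apply, ← Complex.imCLM.integral_comp_comm hkYi]
    simp
  rw [h1, ← measurePreserving_vertCoord.setIntegral_preimage_emb
    vertCoord.toHomeomorph.measurableEmbedding, vertCoord_preimage_openRect]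
  simp only [Function.comp_apply] at hflux
  change Complex.im (∫ w in Ioo 0 ℓ ×ˢ Ioo 0 1, k w.1 • Y (vertCoord w)) = _
  rw [hflux]
  have hcont : Continuous fun s : ℝ => extendRect ℓ g (vertCoord (s, 1)) -
      extendRect ℓ g (vertCoord (s, 0)) := by
    have := vertCoord.continuous
    fun_prop
  have hi : IntegrableOn (fun s : ℝ => k s • (extendRect ℓ g (vertCoord (s, 1)) -
      extendRect ℓ g (vertCoord (s, 0)))) (Ioo 0 ℓ) :=
    Integrable.bdd_smul (φ := k) (hcont.integrableOn_Icc.mono_set Ioo_subset_Icc_self) C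
      hkm.aestronglyMeasurable (ae_of_all _ hk)
  have h2 := Complex.imCLM.integral_comp_comm hi
  simp only [Complex.imCLM_apply] at h2
  rw [← h2, intervalIntegral.integral_of_le hℓ.le, integral_Ioc_eq_integral_Ioo]
  refine setIntegral_congr_fun measurableSet_Ioo fun s hs => ?_
  have m1 : vertCoord (s, 1) ∈ rect ℓ := ⟨Ioo_subset_Icc_self hs, ⟨zero_le_one, le_rfl⟩⟩
  have m0 : vertCoord (s, 0) ∈ rect ℓ := ⟨Ioo_subset_Icc_self hs, ⟨le_rfl, zero_le_one⟩⟩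
  simp only [Complex.smul_im, Complex.sub_im, smul_eq_mul]
  rw [extendRect_eqOn m1, extendRect_eqOn m0, hg.top _ m1 rfl, hg.bottom _ m0 rfl, sub_zero,
    mul_one]

lemma aestronglyMeasurable_comp_distortion (hs : ContDiffOn ℝ ∞ φ (Ici 1)) {X Y : ℂ → ℂ}
    {W : ℝ → ℝ} (hWm : Measurable W) {μ : Measure ℂ} (hX : AEStronglyMeasurable X μ)
    (hY : AEStronglyMeasurable Y μ) :
    AEStronglyMeasurable (fun z => φ (matDistortion (X z).re (X z).im (Y z).re (Y z).im) * W z.re)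
      μ := by
  -- Only the values of `φ` on `[1, ∞)` are known to be continuous, and the distortion is there.
  have hφ : Continuous fun t => φ (max 1 t) :=
    hs.continuousOn.comp_continuous (by fun_prop) fun t => mem_Ici.2 (le_max_left _ _)
  have h1 : AEMeasurable (fun z => φ (max 1 (matDistortion (X z).re (X z).im (Y z).re (Y z).im)))
      μ := hφ.measurable.comp_aemeasurable
        (measurable_matDistortion.comp_aemeasurable (hX.aemeasurable.prodMk hY.aemeasurable))
  have h2 : AEMeasurable (fun z => φ (matDistortion (X z).re (X z).im (Y z).re (Y z).im)) μ := by
    refine h1.congr (ae_of_all _ fun z => ?_)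
    simp only
    rw [max_eq_right]
    linarith [two_le_matDistortion (X z).re (X z).im (Y z).re (Y z).im]
  exact (h2.mul (hWm.comp Complex.measurable_re).aemeasurable).aestronglyMeasurable

/-- The integral form of the area inequality. -/
lemma integrable_jacobian (hℓ : 0 < ℓ) (hL : 0 < L) (hg : Admissible ℓ L g) :
    IntegrableOn (jacobian (openRect ℓ) g) (openRect ℓ) ∧
      ∫ z in openRect ℓ, jacobian (openRect ℓ) g z ≤ L := by
  obtain ⟨⟨-, hX, hY⟩, hJ, -⟩ := hg.finiteDistortion
  replace hX := isWeakPartial_weakPartial hX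
  replace hY := isWeakPartial_weakPartial hY
  have harea := lintegral_jacobian_le hℓ hg.continuousOn hg.bijOn hX hY
  have hXm := hX.1.aestronglyMeasurable.aemeasurable
  have hYm := hY.1.aestronglyMeasurable.aemeasurable
  have hJm : AEStronglyMeasurable (jacobian (openRect ℓ) g) (volume.restrict (openRect ℓ)) :=
    (((Complex.measurable_re.comp_aemeasurable hXm).mul
      (Complex.measurable_im.comp_aemeasurable hYm)).sub
      ((Complex.measurable_im.comp_aemeasurable hXm).mul
      (Complex.measurable_re.comp_aemeasurable hYm))).aestronglyMeasurable
  have hle : ∫⁻ z in openRect ℓ, ENNReal.ofReal (jacobian (openRect ℓ) g z) ≤ ENNReal.ofReal L :=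
    (lintegral_mono fun z => ENNReal.ofReal_le_ofReal (le_abs_self _)).trans harea
  refine ⟨(lintegral_ofReal_ne_top_iff_integrable hJm hJ).1
    (ne_top_of_le_ne_top ENNReal.ofReal_ne_top hle), ?_⟩
  rw [integral_eq_lintegral_of_nonneg_ae hJ hJm]
  exact ENNReal.toReal_le_of_le_ofReal hL.le hle

/-- A map with integrable distortion and integrable Jacobian has integrable derivatives, since
`|Df|² = 𝕂 J`. -/
lemma integrableOn_weakPartial (hg : FiniteDistortion (openRect ℓ) g)
    (hK : IntegrableOn (distortion (openRect ℓ) g) (openRect ℓ))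
    (hJ : IntegrableOn (jacobian (openRect ℓ) g) (openRect ℓ)) :
    IntegrableOn (weakPartial (openRect ℓ) 1 g) (openRect ℓ) ∧
      IntegrableOn (weakPartial (openRect ℓ) Complex.I g) (openRect ℓ) := by
  obtain ⟨⟨-, hX, hY⟩, hJ0, k, hk⟩ := hg
  replace hX := isWeakPartial_weakPartial hX
  replace hY := isWeakPartial_weakPartial hY
  have hle : ∀ᵐ z ∂volume.restrict (openRect ℓ), normDSq (openRect ℓ) g z ≤
      (distortion (openRect ℓ) g z + jacobian (openRect ℓ) g z) ^ 2 ∧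
      0 ≤ distortion (openRect ℓ) g z + jacobian (openRect ℓ) g z := by
    filter_upwards [hJ0, hk] with z h0 h1
    have h2 := two_le_matDistortion (weakPartial (openRect ℓ) 1 g z).re
      (weakPartial (openRect ℓ) 1 g z).im (weakPartial (openRect ℓ) Complex.I g z).re
      (weakPartial (openRect ℓ) Complex.I g z).im
    have h3 : normDSq (openRect ℓ) g z =
        distortion (openRect ℓ) g z * jacobian (openRect ℓ) g z := by
      rw [distortion_eq, normDSq_eq]
      rw [normDSq_eq] at h1
      exact sum_sq_le_matDistortion_mul h0 h1
    rw [← distortion_eq] at h2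
    exact ⟨by rw [h3]; nlinarith, by linarith⟩
  constructor
  · refine (hK.add hJ).mono' hX.1.aestronglyMeasurable ?_
    filter_upwards [hle] with z hz
    exact abs_le_of_sq_le_sq' (le_trans (by rw [normDSq]; simp) hz.1) hz.2 |>.2
  · refine (hK.add hJ).mono' hY.1.aestronglyMeasurable ?_
    filter_upwards [hle] with z hz
    exact abs_le_of_sq_le_sq' (le_trans (by rw [normDSq]; simp) hz.1) hz.2 |>.2

end Energy

/-! ### Existence and uniqueness -/

section Minimiser

variable {φ : ℝ → ℝ} {ℓ L : ℝ} {g : ℂ → ℂ}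

/-- The distortion is integrable if the energy is finite, as `φ` grows at least linearly. -/
lemma integrableOn_distortion (hs : ContDiffOn ℝ ∞ φ (Ici 1)) (hc : ConvexOn ℝ (Ici 1) φ)
    (hi : StrictMonoOn φ (Ici 1)) (hφ : ∀ t ∈ Ici (1 : ℝ), 0 ≤ φ t) {W : ℝ → ℝ} {m : ℝ}
    (hm : 0 < m) (hmW : ∀ x, m ≤ W x) (hg : FiniteDistortion (openRect ℓ) g)
    (hE : IntegrableOn (fun z => φ (distortion (openRect ℓ) g z) * W z.re) (openRect ℓ)) :
    IntegrableOn (distortion (openRect ℓ) g) (openRect ℓ) := by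
  have hc2 : 0 < deriv φ 2 := deriv_pos_of_strictMonoOn hs hc hi (by norm_num)
  obtain ⟨⟨-, hX, hY⟩, -⟩ := hg
  have hXm := (isWeakPartial_weakPartial hX).1.aestronglyMeasurable.aemeasurable
  have hYm := (isWeakPartial_weakPartial hY).1.aestronglyMeasurable.aemeasurable
  have hKm : AEStronglyMeasurable (distortion (openRect ℓ) g) (volume.restrict (openRect ℓ)) := by
    rw [funext (distortion_eq (openRect ℓ) g)]
    exact (measurable_matDistortion.comp_aemeasurable (hXm.prodMk hYm)).aestronglyMeasurable
  refine ((hE.const_mul (1 / (m * deriv φ 2))).add (integrable_const (2 : ℝ))).mono' hKm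
    (ae_of_all _ fun z => ?_)
  have h2 : 2 ≤ distortion (openRect ℓ) g z := by
    rw [distortion_eq]; exact two_le_matDistortion _ _ _ _
  set K := distortion (openRect ℓ) g z with hK
  change ‖K‖ ≤ 1 / (m * deriv φ 2) * (φ K * W z.re) + 2
  rw [Real.norm_of_nonneg (by linarith)]
  have htan := tangent_le hs hc (t := 2) (s := K) (by norm_num) (by linarith)
  have hφ2 := hφ 2 (by norm_num [mem_Ici])
  have hφK := hφ K (mem_Ici.2 (by linarith))
  have h3 : (K - 2) * (m * deriv φ 2) ≤ φ K * W z.re :=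
    calc (K - 2) * (m * deriv φ 2) = deriv φ 2 * (K - 2) * m := by ring
      _ ≤ φ K * m := by gcongr; linarith
      _ ≤ φ K * W z.re := by gcongr; exact hmW _
  have h4 : K - 2 ≤ φ K * W z.re / (m * deriv φ 2) := (le_div_iff₀ (by positivity)).2 h3
  rw [one_div_mul_eq_div]
  linarith

/-- Among admissible maps of finite energy, the energy is at least that of the stretching `p` that
solves the Euler–Lagrange equation, with equality only for maps with the same derivatives. -/
theorem energy_lower (hs : ContDiffOn ℝ ∞ φ (Ici 1)) (hc : ConvexOn ℝ (Ici 1) φ)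
    (hi : StrictMonoOn φ (Ici 1)) (hφ : ∀ t ∈ Ici (1 : ℝ), 0 ≤ φ t) (hℓ : 0 < ℓ) (hL : 0 < L)
    {W : ℝ → ℝ} {m : ℝ} (hm : 0 < m) (hmW : ∀ x, m ≤ W x)
    {α : ℝ} {p : ℝ → ℝ} (hp : Measurable p) {a b : ℝ} (ha : 0 < a) (hap : ∀ x, a ≤ p x)
    (hpb : ∀ x, p x ≤ b) (hα : ∀ x, W x * profileDeriv φ (p x) = α)
    (hpL : ∫ x in (0 : ℝ)..ℓ, p x = L)
    (he : IntegrableOn (fun z : ℂ => φ (p z.re + (p z.re)⁻¹) * W z.re) (openRect ℓ))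
    (hg : Admissible ℓ L g)
    (hE : IntegrableOn (fun z => φ (distortion (openRect ℓ) g z) * W z.re) (openRect ℓ)) :
    ∫ z in openRect ℓ, φ (p z.re + (p z.re)⁻¹) * W z.re ≤
      ∫ z in openRect ℓ, φ (distortion (openRect ℓ) g z) * W z.re ∧
    (∫ z in openRect ℓ, φ (distortion (openRect ℓ) g z) * W z.re ≤
      ∫ z in openRect ℓ, φ (p z.re + (p z.re)⁻¹) * W z.re →
      ∀ᵐ z ∂volume.restrict (openRect ℓ), weakPartial (openRect ℓ) 1 g z = (p z.re : ℂ) ∧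
        weakPartial (openRect ℓ) Complex.I g z = Complex.I) := by
  set μ := volume.restrict (openRect ℓ) with hμ
  set X := weakPartial (openRect ℓ) 1 g with hX
  set Y := weakPartial (openRect ℓ) Complex.I g with hY
  set J := jacobian (openRect ℓ) g with hJ
  set K := distortion (openRect ℓ) g with hK
  have hfd := hg.finiteDistortion
  obtain ⟨⟨-, hXex, hYex⟩, hJ0, k, hk⟩ := hg.finiteDistortion
  have hKi : Integrable K μ := integrableOn_distortion hs hc hi hφ hm hmW hfd hE
  obtain ⟨hJi, hJL⟩ := integrable_jacobian hℓ hL hg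
  obtain ⟨hXi, hYi⟩ := integrableOn_weakPartial hfd hKi hJi
  have hpabs : ∀ x, |p x| ≤ b := fun x => by
    rw [abs_of_pos (ha.trans_le (hap x))]; exact hpb x
  have hXL : ∫ z, (X z).re ∂μ = L := integral_re_eq hℓ hg (isWeakPartial_weakPartial hXex) hXi
  have hYL : ∫ z, p z.re * (Y z).im ∂μ = L := by
    rw [← hpL]
    exact integral_mul_im_eq hℓ hg (isWeakPartial_weakPartial hYex) hYi hp hpabs
  have hpi : Integrable (fun z : ℂ => p z.re) μ :=
    Integrable.of_bound (hp.comp Complex.measurable_re).aestronglyMeasurable b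
      (ae_of_all _ fun z => hpabs _)
  have hpint : ∫ z : ℂ, p z.re ∂μ = L := by
    have := integral_re_eq hℓ (admissible_stretch hℓ hp ha hap hpb hpL)
      (isWeakPartial_stretch_one hp ha hap hpb _) hpi.ofReal
    simpa using this
  have hXri : Integrable (fun z => (X z).re) μ := hXi.re
  have hpYi : Integrable (fun z => p z.re * (Y z).im) μ :=
    Integrable.bdd_mul (c := b) (hYi.im)
      (hp.comp Complex.measurable_re).aestronglyMeasurable (ae_of_all _ fun z => hpabs _)
  -- The integrand of boundary type, whose integral is `2 * L` in both cases.
  set P : ℂ → ℝ := fun z => if 0 < α then 2 * (X z).re else 2 * p z.re * (Y z).im with hP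
  have hPi : Integrable P μ ∧ ∫ z, P z ∂μ = 2 * L := by
    by_cases h : 0 < α
    · simp only [hP, if_pos h]
      exact ⟨hXri.const_mul 2, by rw [integral_const_mul, hXL]⟩
    · simp only [hP, if_neg h, mul_assoc]
      exact ⟨hpYi.const_mul 2, by rw [integral_const_mul, hYL]⟩
  set N : ℂ → ℝ := fun z => |α| * (P z - J z - p z.re) with hN
  have hNi : Integrable N μ := ((hPi.1.sub hJi).sub hpi).const_mul _
  have hN0 : 0 ≤ ∫ z, N z ∂μ := by
    have h1 : ∫ z, N z ∂μ = |α| * (2 * L - ∫ z, J z ∂μ - L) := by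
      have e1 : ∫ z, P z - J z - p z.re ∂μ = (∫ z, P z - J z ∂μ) - ∫ z : ℂ, p z.re ∂μ :=
        integral_sub (hPi.1.sub hJi) hpi
      simp only [hN]
      rw [integral_const_mul, e1, integral_sub hPi.1 hJi, hPi.2, hpint]
    rw [h1]
    exact mul_nonneg (abs_nonneg _) (by linarith)
  set D : ℂ → ℝ := fun z => φ (K z) * W z.re - φ (p z.re + (p z.re)⁻¹) * W z.re with hD
  have hDi : Integrable D μ := hE.sub he
  have hDint : ∫ z, D z ∂μ = ∫ z, φ (K z) * W z.re ∂μ -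
      ∫ z : ℂ, φ (p z.re + (p z.re)⁻¹) * W z.re ∂μ := integral_sub hE he
  have hpt : ∀ᵐ z ∂μ, N z ≤ D z ∧ (N z = D z → (α = 0 → p z.re = 1 ∧ K z = 2) ∧
      (α ≠ 0 → X z = (p z.re : ℂ) ∧ Y z = Complex.I)) := by
    filter_upwards [hJ0, hk] with z h0 h1
    rw [normDSq_eq] at h1
    have h2 := density_lower hs hc hi (hm.trans_le (hmW z.re)) (ha.trans_le (hap z.re))
      (hα z.re) h0 h1
    rw [← distortion_eq] at h2
    refine ⟨h2.1, fun h => ⟨(h2.2 h).1, fun hne => ?_⟩⟩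
    obtain ⟨e1, e2, e3, e4⟩ := (h2.2 h).2 hne
    exact ⟨Complex.ext (by simpa using e1) (by simpa using e2),
      Complex.ext (by simpa using e3) (by simpa using e4)⟩
  have hND : ∫ z, N z ∂μ ≤ ∫ z, D z ∂μ := integral_mono_ae hNi hDi (hpt.mono fun z h => h.1)
  refine ⟨by linarith, fun hle => ?_⟩
  have hsub0 : ∀ᵐ z ∂μ, D z - N z = 0 := by
    have hnn : 0 ≤ᵐ[μ] fun z => D z - N z := hpt.mono fun z h => sub_nonneg.2 h.1
    refine (integral_eq_zero_iff_of_nonneg_ae hnn (hDi.sub hNi)).1 ?_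
    refine le_antisymm ?_ (integral_nonneg_of_ae hnn)
    rw [integral_sub hDi hNi]
    linarith
  by_cases hα0 : α = 0
  · -- Here `p = 1`, and `𝕂 = 2` means conformality; the Dirichlet integral of `g - id` vanishes.
    have hall : ∀ᵐ z ∂μ, p z.re = 1 ∧ ‖X z‖ ^ 2 + ‖Y z‖ ^ 2 = 2 * J z := by
      filter_upwards [hpt, hsub0, hJ0, hk] with z h1 h2 h3 h4
      obtain ⟨e1, e2⟩ := (h1.2 (by linarith)).1 hα0
      refine ⟨e1, ?_⟩
      rw [← e2]
      change normDSq (openRect ℓ) g z = _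
      rw [hK, distortion_eq]
      rw [normDSq_eq] at h4 ⊢
      exact sum_sq_le_matDistortion_mul h3 h4
    set Q : ℂ → ℝ := fun z => 2 * J z - 2 * (X z).re - 2 * (p z.re * (Y z).im) + 2 * p z.re with hQ
    have hJ2 := hJi.const_mul 2
    have hX2 := hXri.const_mul 2
    have hY2 := hpYi.const_mul 2
    have hp2 := hpi.const_mul 2
    have hQi : Integrable Q μ := ((hJ2.sub hX2).sub hY2).add hp2
    have hQint : ∫ z, Q z ∂μ = 2 * ∫ z, J z ∂μ - 2 * L - 2 * L + 2 * L := by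
      have e1 : ∫ z, Q z ∂μ = (∫ z, 2 * J z - 2 * (X z).re - 2 * (p z.re * (Y z).im) ∂μ) +
          ∫ z : ℂ, 2 * p z.re ∂μ := integral_add ((hJ2.sub hX2).sub hY2) hp2
      have e2 : ∫ z, 2 * J z - 2 * (X z).re - 2 * (p z.re * (Y z).im) ∂μ =
          (∫ z, 2 * J z - 2 * (X z).re ∂μ) - ∫ z, 2 * (p z.re * (Y z).im) ∂μ :=
        integral_sub (hJ2.sub hX2) hY2
      have e3 : ∫ z, 2 * J z - 2 * (X z).re ∂μ = (∫ z, 2 * J z ∂μ) - ∫ z, 2 * (X z).re ∂μ :=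
        integral_sub hJ2 hX2
      rw [e1, e2, e3]
      simp only [integral_const_mul, hXL, hYL, hpint]
    have hQsq : ∀ᵐ z ∂μ, Q z = ‖X z - 1‖ ^ 2 + ‖Y z - Complex.I‖ ^ 2 := by
      filter_upwards [hall] with z hz
      have h1 := hz.2
      simp only [hQ, hz.1, Complex.sq_norm, Complex.normSq_apply] at h1 ⊢
      simp
      linarith
    have hQ0 : ∀ᵐ z ∂μ, Q z = 0 := by
      have hnn : 0 ≤ᵐ[μ] Q := hQsq.mono fun z h => by
        rw [h]; change (0 : ℝ) ≤ _; positivity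
      refine (integral_eq_zero_iff_of_nonneg_ae hnn hQi).1 ?_
      refine le_antisymm ?_ (integral_nonneg_of_ae hnn)
      rw [hQint]
      linarith
    filter_upwards [hall, hQsq, hQ0] with z h1 h2 h3
    rw [h3] at h2
    have hx : ‖X z - 1‖ = 0 := (pow_eq_zero_iff two_ne_zero).1
      (by linarith [sq_nonneg ‖X z - 1‖, sq_nonneg ‖Y z - Complex.I‖])
    have hy : ‖Y z - Complex.I‖ = 0 := (pow_eq_zero_iff two_ne_zero).1
      (by linarith [sq_nonneg ‖X z - 1‖, sq_nonneg ‖Y z - Complex.I‖])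
    rw [norm_eq_zero, sub_eq_zero] at hx hy
    rw [h1.1, Complex.ofReal_one]
    exact ⟨hx, hy⟩
  · filter_upwards [hpt, hsub0] with z h1 h2
    exact (h1.2 (by linarith)).2 hα0

/-- If the weak derivative depends on the second variable only, then the fundamental theorem of
calculus holds on every line of the closed box, by continuity. -/
lemma IsWeakPartialSnd.eq_add_integral {A B : ℝ} {F H : ℝ × ℝ → ℂ} (hA : 0 < A) (hB : 0 < B)
    (hF : Continuous F) (hw : IsWeakPartialSnd A B F H) (hH : IntegrableOn H (Ioo 0 A ×ˢ Ioo 0 B))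
    {k : ℝ → ℂ} (hk : ∀ᵐ w ∂volume.restrict (Ioo 0 A ×ˢ Ioo 0 B), H w = k w.2) {s b : ℝ}
    (hs : s ∈ Icc 0 A) (hb : b ∈ Icc 0 B) : F (s, b) = F (s, 0) + ∫ t in (0 : ℝ)..b, k t := by
  have hk' : ∀ᵐ s, s ∈ Ioo 0 A → ∀ᵐ t, t ∈ Ioo 0 B → H (s, t) = k t := by
    rw [Measure.volume_eq_prod, ← Measure.prod_restrict] at hk
    filter_upwards [(ae_restrict_iff' measurableSet_Ioo).1 (Measure.ae_ae_of_ae_prod hk)]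
      with s hs hsA
    exact (ae_restrict_iff' measurableSet_Ioo).1 (hs hsA)
  have hae : (fun s => F (s, b)) =ᵐ[volume.restrict (Ioo 0 A)]
      fun s => F (s, 0) + ∫ t in (0 : ℝ)..b, k t := by
    refine (ae_restrict_iff' measurableSet_Ioo).2 ?_
    filter_upwards [hw.ae_eq_add_integral hB hF hH, hk'] with s h1 h2 hsA
    rw [h1 hsA b hb]
    congr 1
    refine intervalIntegral.integral_congr_ae ?_
    filter_upwards [h2 hsA, (measure_eq_zero_iff_ae_notMem.1 (measure_singleton B))]
      with t h3 h4 ht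
    rw [uIoc_of_le hb.1] at ht
    refine h3 ⟨ht.1, lt_of_le_of_ne (ht.2.trans hb.2) fun h => h4 (mem_singleton_iff.2 h)⟩
  have hc1 : Continuous fun s => F (s, b) := by fun_prop
  have hc2 : Continuous fun s => F (s, 0) + ∫ t in (0 : ℝ)..b, k t := by fun_prop
  have heq := Measure.eqOn_open_of_ae_eq hae isOpen_Ioo hc1.continuousOn hc2.continuousOn
  refine (heq.of_subset_closure hc1.continuousOn hc2.continuousOn Ioo_subset_Icc_self ?_) hs
  rw [closure_Ioo hA.ne]

/-- An admissible map with the derivatives of a stretching is that stretching. -/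
lemma eqOn_stretch_of_weakPartial (hℓ : 0 < ℓ) (hg : Admissible ℓ L g) {p : ℝ → ℝ}
    (hp : Measurable p) {b : ℝ} (hpb : ∀ x, |p x| ≤ b)
    (h : ∀ᵐ z ∂volume.restrict (openRect ℓ), weakPartial (openRect ℓ) 1 g z = (p z.re : ℂ) ∧
        weakPartial (openRect ℓ) Complex.I g z = Complex.I) : EqOn g (stretch p) (rect ℓ) := by
  obtain ⟨⟨-, hX, hY⟩, -⟩ := hg.finiteDistortion
  replace hX := isWeakPartial_weakPartial hX
  replace hY := isWeakPartial_weakPartial hY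
  have hG := continuous_extendRect hℓ hg.continuousOn
  have hpi : IntegrableOn (fun z : ℂ => (p z.re : ℂ)) (openRect ℓ) :=
    Integrable.of_bound (Complex.measurable_ofReal.comp
      (hp.comp Complex.measurable_re)).aestronglyMeasurable b
      (ae_of_all _ fun z => by simpa using hpb z.re)
  have hXi : IntegrableOn (weakPartial (openRect ℓ) 1 g) (openRect ℓ) :=
    hpi.congr (h.mono fun z hz => hz.1.symm)
  have hYi : IntegrableOn (weakPartial (openRect ℓ) Complex.I g) (openRect ℓ) :=
    (integrable_const Complex.I).congr (h.mono fun z hz => hz.2.symm)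
  have hhor := (measurePreserving_horizCoord.restrict_preimage_emb
    horizCoord.toHomeomorph.measurableEmbedding (openRect ℓ)).quasiMeasurePreserving.ae h
  have hver := (measurePreserving_vertCoord.restrict_preimage_emb
    vertCoord.toHomeomorph.measurableEmbedding (openRect ℓ)).quasiMeasurePreserving.ae h
  rw [horizCoord_preimage_openRect] at hhor
  rw [vertCoord_preimage_openRect] at hver
  intro z hz
  have hz' := mem_rect.1 hz
  have e1 := (weakPartialSnd_horiz hX).eq_add_integral one_pos hℓ (hG.comp horizCoord.continuous)
    (integrableOn_comp_horizCoord hXi) (k := fun t => (p t : ℂ)) (hhor.mono fun w hw => hw.1)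
    (s := z.im) (b := z.re) hz.2 hz.1
  have e2 := (weakPartialSnd_vert hY).eq_add_integral hℓ one_pos (hG.comp vertCoord.continuous)
    (integrableOn_comp_vertCoord hYi) (k := fun _ => Complex.I) (hver.mono fun w hw => hw.2)
    (s := z.re) (b := z.im) hz.1 hz.2
  have m1 : horizCoord (z.im, 0) ∈ rect ℓ := ⟨⟨le_rfl, hℓ.le⟩, hz.2⟩
  have m2 : vertCoord (z.re, 0) ∈ rect ℓ := ⟨hz.1, ⟨le_rfl, zero_le_one⟩⟩
  have c1 : horizCoord (z.im, z.re) = z := rfl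
  have c2 : vertCoord (z.re, z.im) = z := rfl
  simp only [Function.comp_apply, c1, c2, extendRect_eqOn hz, extendRect_eqOn m1,
    extendRect_eqOn m2] at e1 e2
  refine Complex.ext ?_ ?_
  · rw [e1, stretch_re, Complex.add_re, hg.left _ m1 rfl, zero_add,
      intervalIntegral.integral_ofReal, Complex.ofReal_re]
  · rw [e2, stretch_im, Complex.add_im, hg.bottom _ m2 rfl, zero_add,
      intervalIntegral.integral_const]
    simp

/-- A bounded measurable weight on the line, bounded away from zero, that agrees almost everywhere
on the interval with a given piecewise continuous one. -/
lemma exists_measurable_weight (hℓ : 0 < ℓ) {w : ℝ → ℝ} (hw : PiecewiseContinuous ℓ w) {m M : ℝ}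
    (hm : ∀ x ∈ Icc 0 ℓ, m ≤ w x) (hM : ∀ x ∈ Icc 0 ℓ, w x ≤ M) :
    ∃ W : ℝ → ℝ, Measurable W ∧ (∀ x, m ≤ W x) ∧ (∀ x, W x ≤ M) ∧
      ∀ᵐ x, x ∈ Icc 0 ℓ → W x = w x := by
  obtain ⟨S, hS, hcont⟩ := hw
  have hmM : m ≤ M := (hm 0 ⟨le_rfl, hℓ.le⟩).trans (hM 0 ⟨le_rfl, hℓ.le⟩)
  have hwm : AEMeasurable w (volume.restrict (Icc 0 ℓ)) := by
    have hc : ContinuousOn w (Icc 0 ℓ \ S) := fun x hx => (hcont x hx).mono sdiff_subset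
    have := hc.aemeasurable (μ := volume) (measurableSet_Icc.diff hS.measurableSet)
    rwa [Measure.restrict_congr_set (sdiff_null_ae_eq_self (hS.measure_zero volume))] at this
  refine ⟨fun x => max m (min M (hwm.mk w x)),
    measurable_const.max (measurable_const.min hwm.measurable_mk), fun x => le_max_left _ _,
    fun x => max_le hmM (min_le_left _ _), ?_⟩
  filter_upwards [(ae_restrict_iff' measurableSet_Icc).1 hwm.ae_eq_mk] with x hx hxI
  rw [← hx hxI, min_eq_right (hM x hxI), max_eq_right (hm x hxI)]

lemma energy_eq (φ : ℝ → ℝ) {w W : ℝ → ℝ} (hW : ∀ᵐ x, x ∈ Icc 0 ℓ → W x = w x) (g : ℂ → ℂ) :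
    energy ℓ φ w g =
      ∫⁻ z in openRect ℓ, ENNReal.ofReal (φ (distortion (openRect ℓ) g z) * W z.re) := by
  rw [energy, ← setLIntegral_congr openRect_ae_eq_rect]
  refine setLIntegral_congr_fun_ae isOpen_openRect.measurableSet ?_
  filter_upwards [quasiMeasurePreserving_re.ae hW] with z hz hzR
  rw [hz (openRect_subset_rect hzR).1]

lemma density_nonneg (hφ : ∀ t ∈ Ici (1 : ℝ), 0 ≤ φ t) {W : ℝ → ℝ} (hW : ∀ x, 0 < W x) (z : ℂ) :
    0 ≤ φ (distortion (openRect ℓ) g z) * W z.re := by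
  have h : 2 ≤ distortion (openRect ℓ) g z := by
    rw [distortion_eq]; exact two_le_matDistortion _ _ _ _
  exact mul_nonneg (hφ _ (mem_Ici.2 (by linarith))) (hW _).le

lemma integrable_density (hs : ContDiffOn ℝ ∞ φ (Ici 1)) (hφ : ∀ t ∈ Ici (1 : ℝ), 0 ≤ φ t)
    {w W : ℝ → ℝ} (hWm : Measurable W) (hW : ∀ x, 0 < W x)
    (hWw : ∀ᵐ x, x ∈ Icc 0 ℓ → W x = w x) (hg : Admissible ℓ L g) (hfin : energy ℓ φ w g ≠ ⊤) :
    IntegrableOn (fun z => φ (distortion (openRect ℓ) g z) * W z.re) (openRect ℓ) := by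
  obtain ⟨⟨-, hX, hY⟩, -⟩ := hg.finiteDistortion
  have hmeas := aestronglyMeasurable_comp_distortion hs hWm
    (isWeakPartial_weakPartial hX).1.aestronglyMeasurable
    (isWeakPartial_weakPartial hY).1.aestronglyMeasurable
  simp only [← distortion_eq] at hmeas
  rw [energy_eq φ hWw] at hfin
  exact (lintegral_ofReal_ne_top_iff_integrable hmeas
    (ae_of_all _ fun z => density_nonneg hφ hW z)).1 hfin

lemma energy_eq_ofReal_integral (hφ : ∀ t ∈ Ici (1 : ℝ), 0 ≤ φ t) {w W : ℝ → ℝ}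
    (hW : ∀ x, 0 < W x) (hWw : ∀ᵐ x, x ∈ Icc 0 ℓ → W x = w x)
    (hi : IntegrableOn (fun z => φ (distortion (openRect ℓ) g z) * W z.re) (openRect ℓ)) :
    energy ℓ φ w g =
      ENNReal.ofReal (∫ z in openRect ℓ, φ (distortion (openRect ℓ) g z) * W z.re) := by
  rw [energy_eq φ hWw, ofReal_integral_eq_lintegral_ofReal hi
    (ae_of_all _ fun z => density_nonneg hφ hW z)]

lemma matDistortion_diag {q : ℝ} (hq : 0 < q) : matDistortion q 0 0 1 = q + q⁻¹ := by
  simp [matDistortion, hq]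
  field_simp

/-- The energy density of a stretching with bounded profile is bounded. -/
lemma integrable_density_stretch (hs : ContDiffOn ℝ ∞ φ (Ici 1)) (hi : StrictMonoOn φ (Ici 1))
    (hφ : ∀ t ∈ Ici (1 : ℝ), 0 ≤ φ t) {W : ℝ → ℝ} (hWm : Measurable W) (hW : ∀ x, 0 < W x) {M : ℝ}
    (hWM : ∀ x, W x ≤ M) {p : ℝ → ℝ} (hp : Measurable p) {a b : ℝ} (ha : 0 < a)
    (hap : ∀ x, a ≤ p x) (hpb : ∀ x, p x ≤ b) :
    IntegrableOn (fun z : ℂ => φ (p z.re + (p z.re)⁻¹) * W z.re) (openRect ℓ) := by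
  have hppos : ∀ x, 0 < p x := fun x => ha.trans_le (hap x)
  have hmeas := aestronglyMeasurable_comp_distortion (μ := volume.restrict (openRect ℓ))
    hs hWm (X := fun z => (p z.re : ℂ)) (Y := fun _ => Complex.I)
    (Complex.measurable_ofReal.comp (hp.comp Complex.measurable_re)).aestronglyMeasurable
    aestronglyMeasurable_const
  simp only [Complex.ofReal_re, Complex.ofReal_im, Complex.I_re, Complex.I_im,
    matDistortion_diag (hppos _)] at hmeas
  refine Integrable.of_bound hmeas (φ (b + a⁻¹) * M) (ae_of_all _ fun z => ?_)
  have h2 := two_le_add_inv (hppos z.re)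
  have hle : p z.re + (p z.re)⁻¹ ≤ b + a⁻¹ := add_le_add (hpb _) (inv_anti₀ ha (hap _))
  have h1 : p z.re + (p z.re)⁻¹ ∈ Ici (1 : ℝ) := mem_Ici.2 (by linarith)
  have hbd : b + a⁻¹ ∈ Ici (1 : ℝ) := mem_Ici.2 (by linarith)
  rw [Real.norm_of_nonneg (mul_nonneg (hφ _ h1) (hW _).le)]
  exact mul_le_mul (hi.monotoneOn h1 hbd hle) (hWM _) (hW _).le (hφ _ hbd)

end Minimiser

end Grotzsch

theorem mainTheorem2 (ℓ L : ℝ) (hℓ : 0 < ℓ) (hL : 0 < L) (w φ : ℝ → ℝ)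
    (hw : Grotzsch.PiecewiseContinuous ℓ w)
    (hw_below : ∃ m : ℝ, 0 < m ∧ ∀ x ∈ Icc 0 ℓ, m ≤ w x)
    (hw_above : ∃ M : ℝ, ∀ x ∈ Icc 0 ℓ, w x ≤ M)
    (hφ_nonneg : ∀ t ∈ Ici (1 : ℝ), 0 ≤ φ t)
    (hφ_smooth : ContDiffOn ℝ ∞ φ (Ici 1))
    (hφ_convex : ConvexOn ℝ (Ici 1) φ)
    (hφ_incr : StrictMonoOn φ (Ici 1))
    (hφ_unbdd : ¬ BddAbove (deriv φ '' Ioi 1)) :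
    ∃ f : ℂ → ℂ, Grotzsch.IsMinimiser ℓ L φ w f ∧
      (∃ u : ℝ → ℝ, ∀ z ∈ Grotzsch.rect ℓ, f z = (u z.re : ℂ) + (z.im : ℂ) * Complex.I) ∧
      ∀ g, Grotzsch.IsMinimiser ℓ L φ w g → EqOn g f (Grotzsch.rect ℓ) := by
  obtain ⟨m, hm, hmw⟩ := hw_below
  obtain ⟨M, hMw⟩ := hw_above
  obtain ⟨W, hWm, hmW, hWM, hWw⟩ := Grotzsch.exists_measurable_weight hℓ hw hmw hMw
  obtain ⟨α, p, hp, ⟨a, ha, hap⟩, ⟨b, hpb⟩, hα, hpL⟩ :=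
    Grotzsch.exists_profile hφ_smooth hφ_convex hφ_incr hφ_unbdd hℓ hL hWm hm hmW hWM
  have hW : ∀ x, 0 < W x := fun x => hm.trans_le (hmW x)
  have hf := Grotzsch.admissible_stretch hℓ hp ha hap hpb hpL
  have he := Grotzsch.integrable_density_stretch (ℓ := ℓ) hφ_smooth hφ_incr hφ_nonneg hWm hW hWM
    hp ha hap hpb
  have hae := Grotzsch.ae_distortion_stretch (ℓ := ℓ) hp ha hap hpb
  have hfi := he.congr (g := fun z => φ (Grotzsch.distortion (Grotzsch.openRect ℓ)
    (Grotzsch.stretch p) z) * W z.re) (hae.mono fun z hz => by simp only [hz])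
  have hfE := Grotzsch.energy_eq_ofReal_integral hφ_nonneg hW hWw hfi
  rw [integral_congr_ae (g := fun z : ℂ => φ (p z.re + (p z.re)⁻¹) * W z.re)
    (hae.mono fun z hz => by simp only [hz])] at hfE
  have hlower := fun g hg hi => Grotzsch.energy_lower (g := g) hφ_smooth hφ_convex hφ_incr hφ_nonneg
    hℓ hL hm hmW hp ha hap hpb hα hpL he hg hi
  refine ⟨Grotzsch.stretch p, ⟨hf, by rw [hfE]; exact ENNReal.ofReal_ne_top, fun g hg => ?_⟩,
    ⟨fun x => ∫ t in (0 : ℝ)..x, p t, fun z _ => rfl⟩, fun g ⟨hg, hfin, hmin⟩ => ?_⟩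
  · by_cases hfin : Grotzsch.energy ℓ φ w g = ⊤
    · rw [hfin]; exact le_top
    · have hi := Grotzsch.integrable_density hφ_smooth hφ_nonneg hWm hW hWw hg hfin
      rw [Grotzsch.energy_eq_ofReal_integral hφ_nonneg hW hWw hi, hfE]
      exact ENNReal.ofReal_le_ofReal (hlower g hg hi).1
  · have hi := Grotzsch.integrable_density hφ_smooth hφ_nonneg hWm hW hWw hg hfin
    have hle := hmin _ hf
    have hnn : 0 ≤ ∫ z in Grotzsch.openRect ℓ, φ (p z.re + (p z.re)⁻¹) * W z.re :=
      integral_nonneg fun z => mul_nonneg (hφ_nonneg _ (mem_Ici.2 (by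
        linarith [Grotzsch.two_le_add_inv (ha.trans_le (hap z.re))]))) (hW _).le
    rw [Grotzsch.energy_eq_ofReal_integral hφ_nonneg hW hWw hi, hfE,
      ENNReal.ofReal_le_ofReal_iff hnn] at hle
    exact Grotzsch.eqOn_stretch_of_weakPartial hℓ hg hp
      (fun x => by rw [abs_of_pos (ha.trans_le (hap x))]; exact hpb x) ((hlower g hg hi).2 hle)
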